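/- **Setting.** Let $(X,d)$ be a finite metric space of doubling dimension at most $k$ (every ball $B(x,2\rho)$, $\rho>0$, is covered by at most $2^k$ balls of radius $\rho$; balls are closed) in which distinct points are at distance at least $1$. Let $s\ge 4$ and $0<\varepsilon<1$. Let $\cdots\subseteq N_2\subseteq N_1\subseteq N_0=N_{-1}=\cdots=X$ be hierarchical nets: for every $i\ge 1$, $N_i\subseteq N_{i-1}$ is an $s^i$-net for $N_{i-1}$, i.e. distinct points of $N_i$ are more than $s^i$ apart and every point of $N_{i-1}$ is within distance $s^i$ of $N_i$. An instance $W=(T,\pi)$ of a prize collecting problem consists of a finite set $T\subseteq X$ of terminals and penalties $\pi:T\to[0,\infty)$. A solution is a finite multiset $F$ of edges $\{x,y\}$ of points of $X$ which is either a single self-loop, or consists of edges with distinct endpoints and is nonempty and such that * (prize collecting TSP) the edges of $F$ form a circuit, i.e. some closed walk traverses each edge exactly as often as it occurs in $F$ (points may be visited several times); respectively * (prize collecting Steiner tree) the edges of $F$ form a connected graph on the set $V(F)$ of their endpoints. Its weight is $w(F)=\sum_{\{x,y\}\in F}d(x,y)$ and its cost is $c_W(F)=w(F)+\sum_{v\in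 T\setminus V(F)}\pi(v)$. For $S\subseteq X$, $F|_S$ is the multiset of edges of $F$ with both endpoints in $S$. A solution $F$ is net-respecting if, for each edge $\{x,y\}\in F$ and each integer $j$ with $s^j\le\varepsilon\, d(x,y)<s^{j+1}$, both $x,y\in N_j$. An optimal net-respecting solution is one of minimum cost among all net-respecting solutions. For $u\in X$ and $r\ge0$, let $W|_{B(u,r)}$ be the instance with terminal set $T\cap B(u,r)$ and the same penalties. **Lemma (Local Sparsity Estimator).** There are universal constants $C_1,C_2>0$ such that the following holds for both problems and all $X,k,s,\varepsilon,(N_i)$ as above. Let $F$ be an optimal net-respecting solution of an instance $W=(T,\pi)$. Then for every height $i\ge1$, every $u\in N_i$, every real $t\ge1$, and every net-respecting solution $F'$ of the sub-instance $W^{(i,t+1)}_u:=W|_{B(u,(t+1)s^i)}$ (in particular for the net-respecting approximate solution $F^{(i,t+1)}_u$ obtained by making the output of a $2$-approximation algorithm net-respecting), $$w\bigl(F|_{B(u,ts^i)}\bigr)\;\le\; c_{W^{(i,t+1)}_u}(F')+\Bigl(\frac{C_1\,skt}{\varepsilon}\Bigr)^{C_2k}\cdot s^i .$$ -/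

import Mathlib

open scoped NNReal

namespace PrizeCollecting

/-- The metric space `X` has doubling dimension at most `k`: every ball of radius `2ρ` is covered
by at most `2 ^ k` balls of radius `ρ`. -/
def DoublingDimLE (X : Type*) [MetricSpace X] (k : ℝ) : Prop :=
  ∀ (x : X) (ρ : ℝ), 0 < ρ → ∃ Z : Finset X, (Z.card : ℝ) ≤ (2 : ℝ) ^ k ∧
    Metric.closedBall x (2 * ρ) ⊆ ⋃ z ∈ Z, Metric.closedBall z ρ

/-- `S` is a `ρ`-net for `Z`: a subset of `Z` which is a `ρ`-packing (distinct points are more than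
`ρ` apart) and a `ρ`-cover for `Z`. -/
structure IsNet {X : Type*} [MetricSpace X] (ρ : ℝ) (S Z : Set X) : Prop where
  subset : S ⊆ Z
  packing : ∀ x ∈ S, ∀ y ∈ S, x ≠ y → ρ < dist x y
  cover : ∀ z ∈ Z, ∃ x ∈ S, dist x z ≤ ρ

/-- Hierarchical nets `⋯ ⊆ N 2 ⊆ N 1 ⊆ N 0 = N (-1) = ⋯ = X`, where `N i` is an `s ^ i`-net
for `N (i - 1)` for every height `i ≥ 1`. -/
structure IsHierarchicalNet {X : Type*} [MetricSpace X] (s : ℝ) (N : ℤ → Set X) : Prop where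
  eq_univ : ∀ i : ℤ, i ≤ 0 → N i = Set.univ
  isNet : ∀ i : ℤ, 1 ≤ i → IsNet (s ^ i) (N i) (N (i - 1))

/-- The length `d(x, y)` of the edge `{x, y}`; a self-loop has length `0`. -/
def edgeLength {X : Type*} [MetricSpace X] : Sym2 X → ℝ :=
  Sym2.lift ⟨fun x y => dist x y, fun x y => dist_comm x y⟩

/-- The weight `w(F)` of a multiset of edges. -/
def weight {X : Type*} [MetricSpace X] (F : Multiset (Sym2 X)) : ℝ :=
  (F.map edgeLength).sum

/-- The vertex set `V(F)` of a multiset of edges. -/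
def vertexSet {X : Type*} (F : Multiset (Sym2 X)) : Set X :=
  {x | ∃ e ∈ F, x ∈ e}

open Classical in
/-- The edges `F|_S` of `F` both of whose endpoints lie in `S`, with multiplicity. -/
noncomputable def restrict {X : Type*} (F : Multiset (Sym2 X)) (S : Set X) :
    Multiset (Sym2 X) :=
  F.filter fun e => ∀ x ∈ e, x ∈ S

/-- `F` is net-respecting with respect to the nets `N` (for the scale base `s`) and `ε`. -/
def NetRespecting {X : Type*} [MetricSpace X] (s ε : ℝ) (N : ℤ → Set X)
    (F : Multiset (Sym2 X)) : Prop :=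
  ∀ x y : X, s(x, y) ∈ F → ∀ i : ℤ, s ^ i ≤ ε * dist x y → ε * dist x y < s ^ (i + 1) →
    x ∈ N i ∧ y ∈ N i

/-- The two prize collecting problems: travelling salesman and Steiner tree. -/
inductive Problem where
  | tsp
  | stp

/-- An instance: a finite set of terminals, with nonnegative penalties (only the penalties of
terminals matter). -/
structure Instance (X : Type*) where
  terminals : Finset X
  penalty : X → ℝ≥0

open Classical in
/-- The sub-instance with terminal set `T ∩ B(u, r)` and the same penalties. -/
noncomputable def Instance.subBall {X : Type*} [MetricSpace X] (W : Instance X) (u : X) (r : ℝ) :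
    Instance X where
  terminals := W.terminals.filter fun v => v ∈ Metric.closedBall u r
  penalty := W.penalty

open Classical in
/-- The cost `c_W(F) = w(F) + π(T ∖ V(F))`. -/
noncomputable def cost {X : Type*} [MetricSpace X] (W : Instance X) (F : Multiset (Sym2 X)) : ℝ :=
  weight F + ∑ v ∈ W.terminals.filter (fun v => v ∉ vertexSet F), (W.penalty v : ℝ)

/-- Feasible solutions.  In both problems a single self-loop is allowed.  Otherwise, for the
travelling salesman problem, the edges of the multiset `F` form a circuit: some closed walk
traverses each edge exactly as often as it occurs in `F` (points may be visited repeatedly).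
For the Steiner tree problem, the edges of `F` form a connected graph on `V(F)`. -/
def IsSolution {X : Type*} : Problem → Multiset (Sym2 X) → Prop
  | .tsp, F => (∃ x : X, F = {s(x, x)}) ∨
      ∃ (v : X) (p : (⊤ : SimpleGraph X).Walk v v), ¬ p.Nil ∧ (p.edges : Multiset (Sym2 X)) = F
  | .stp, F => (∃ x : X, F = {s(x, x)}) ∨
      (F ≠ 0 ∧ (∀ e ∈ F, ¬ e.IsDiag) ∧
        ∀ x ∈ vertexSet F, ∀ y ∈ vertexSet F,
          (SimpleGraph.fromEdgeSet {e | e ∈ F}).Reachable x y)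

/-- `F` is an optimal net-respecting solution of the instance `W`. -/
def IsOptimalNR {X : Type*} [MetricSpace X] (P : Problem) (s ε : ℝ) (N : ℤ → Set X)
    (W : Instance X) (F : Multiset (Sym2 X)) : Prop :=
  IsSolution P F ∧ NetRespecting s ε N F ∧
    ∀ F' : Multiset (Sym2 X), IsSolution P F' → NetRespecting s ε N F' → cost W F ≤ cost W F'

end PrizeCollecting

/-!
The proof is an exchange argument: the part of the optimal solution `F` inside a ball `B(u, r)` is
replaced by the local solution `F'` together with a cheap net-respecting patch, and the radius `r`
varies between `t s ^ i` and `(t + 1) s ^ i`. Write `w(r)` for the weight of `F` inside `B(u, r)`.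

**Exchange** (`weight_restrict_le`). Deleting the edges of `F` inside `B(u, r)` leaves edge sets
hanging off the points where `F` crosses the sphere. For any height `j ≤ i`, every such point
climbs to a point of `N j` at cost at most `4/3 s ^ j` (`exists_climb`), and all net points in a
ball of radius `R = 3 t s ^ i` are joined to `u` at cost `O(s R)` each (`nrJoin_of_dist_le`). A
crossing edge of length at least `s ^ j / ε` already ends in `N j` because `F` is net-respecting,
so only shorter crossing edges contribute to the climbing cost. Using each connecting walk once or
twice makes all degrees even (`exists_connector`), so that, by Euler's theorem (`exists_circuit`),
the same replacement serves the travelling salesman and the Steiner tree. Optimality of `F` gives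
`w(r) ≤ cost F' + (8/3) s ^ j n + 14 s R m`, where `n` counts the short crossing edges and `m`,
the number of net points, is at most `(8 R / s ^ j) ^ k` by the packing bound (`card_net_le`).

**Growth** (`two_mul_le_excess`, `le_threshold_of_doubling`). If the excess `w(r) - cost F'` is at
least twice the net-point term, then `n` is at least of order excess divided by `s ^ j`;
integrating over `r` (`weight_restrict_add_le`), the excess doubles when `r` grows by
`7 s ^ j / ε`. After `O(k s)` doublings the excess dominates the net-point term of height `j - 1`,
and the argument goes on at that finer height, on which the radius grows `s` times more slowly.
The increments of the radius form a geometric series, so if `s ^ j` is initially about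
`ε s ^ i / (k s)` they all fit between `t s ^ i` and `(t + 1) s ^ i`, and the excess would be
unbounded. Hence the excess at radius `t s ^ i` is below the first threshold, which is
`(O(s k t / ε)) ^ (3 k) s ^ i`. That `k ≥ 1` in a space with two points (`DoublingDimLE.one_le`)
absorbs the numerical constants.
-/

open scoped NNReal

namespace PrizeCollecting

/-! ### Edge multisets: mod-two boundary, connectedness, and closed walks -/

open Classical in
/-- The mod-two boundary `δ_a + δ_b` of the edge `{a, b}`; a self-loop has boundary `0`. -/
noncomputable def edgeBoundary {X : Type*} : Sym2 X → X → ZMod 2 :=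
  Sym2.lift ⟨fun a b => Pi.single a 1 + Pi.single b 1, fun _ _ => add_comm _ _⟩

/-- The mod-two boundary of a multiset of edges: the parity of the degree at each point. -/
noncomputable def boundary {X : Type*} (F : Multiset (Sym2 X)) : X → ZMod 2 :=
  (F.map edgeBoundary).sum

/-- The edges of `F` form a connected graph on the set of their endpoints. -/
def EdgeConnected {X : Type*} (F : Multiset (Sym2 X)) : Prop :=
  ∀ x ∈ vertexSet F, ∀ y ∈ vertexSet F, (SimpleGraph.fromEdgeSet {e | e ∈ F}).Reachable x y

section
variable {X : Type*}

open Classical in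
@[simp] lemma edgeBoundary_mk (a b : X) :
    edgeBoundary s(a, b) = Pi.single a 1 + Pi.single b 1 := rfl

@[simp] lemma boundary_zero : boundary (0 : Multiset (Sym2 X)) = 0 := by simp [boundary]

lemma boundary_add (F G : Multiset (Sym2 X)) : boundary (F + G) = boundary F + boundary G := by
  simp [boundary]

lemma boundary_add_self (F : Multiset (Sym2 X)) : boundary (F + F) = 0 := by
  rw [boundary_add]; funext v; exact CharTwo.add_self_eq_zero _

lemma boundary_cons (e : Sym2 X) (F : Multiset (Sym2 X)) :
    boundary (e ::ₘ F) = edgeBoundary e + boundary F := by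
  simp [boundary]

lemma boundary_eq_zero_of_forall_notMem {F : Multiset (Sym2 X)} {v : X}
    (h : ∀ w, s(v, w) ∉ F) : boundary F v = 0 := by
  classical
  induction F using Multiset.induction with
  | empty => simp
  | cons e F ih =>
    rw [boundary_cons, Pi.add_apply, ih fun w hw => h w (by simp [hw]), add_zero]
    induction e with | _ a b
    have ha : v ≠ a := by rintro rfl; exact h b (by simp)
    have hb : v ≠ b := by rintro rfl; exact h a (by simp [Sym2.eq_swap])
    simp [ha, hb]

lemma exists_mem_of_boundary_ne_zero {F : Multiset (Sym2 X)} {v : X} (h : boundary F v ≠ 0) :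
    ∃ w, s(v, w) ∈ F := by
  contrapose! h
  exact boundary_eq_zero_of_forall_notMem h

open Classical in
lemma boundary_edges {G : SimpleGraph X} {x y : X} (p : G.Walk x y) :
    boundary (p.edges : Multiset (Sym2 X)) = Pi.single x 1 + Pi.single y 1 := by
  induction p with
  | nil => funext v; simp [CharTwo.add_self_eq_zero]
  | @cons a b c h p ih =>
    rw [SimpleGraph.Walk.edges_cons, ← Multiset.cons_coe, boundary_cons, ih, edgeBoundary_mk]
    have : (Pi.single b 1 + Pi.single b 1 : X → ZMod 2) = 0 := by
      funext v; exact CharTwo.add_self_eq_zero _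
    linear_combination this

/-- The handshake lemma modulo two. -/
lemma sum_boundary [Fintype X] (F : Multiset (Sym2 X)) : ∑ v, boundary F v = 0 := by
  classical
  induction F using Multiset.induction with
  | empty => simp
  | cons e F ih =>
    simp only [boundary_cons, Pi.add_apply, Finset.sum_add_distrib, ih, add_zero]
    induction e with | _ a b
    simp [Finset.sum_add_distrib, CharTwo.add_self_eq_zero]

lemma vertexSet_add (F G : Multiset (Sym2 X)) :
    vertexSet (F + G) = vertexSet F ∪ vertexSet G := by
  ext x; simp only [vertexSet, Multiset.mem_add, Set.mem_ofPred_eq, Set.mem_union]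
  constructor
  · rintro ⟨e, h | h, hx⟩
    exacts [Or.inl ⟨e, h, hx⟩, Or.inr ⟨e, h, hx⟩]
  · rintro (⟨e, h, hx⟩ | ⟨e, h, hx⟩)
    exacts [⟨e, Or.inl h, hx⟩, ⟨e, Or.inr h, hx⟩]

lemma reachable_mono {F G : Multiset (Sym2 X)} (h : F ⊆ G) {x y : X}
    (hr : (SimpleGraph.fromEdgeSet {e | e ∈ F}).Reachable x y) :
    (SimpleGraph.fromEdgeSet {e | e ∈ G}).Reachable x y :=
  hr.mono (SimpleGraph.fromEdgeSet_mono fun _ he => h he)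

lemma reachable_of_mem {F : Multiset (Sym2 X)} {x y : X} (h : s(x, y) ∈ F) :
    (SimpleGraph.fromEdgeSet {e | e ∈ F}).Reachable x y := by
  by_cases hxy : x = y
  · subst hxy; rfl
  · exact SimpleGraph.Adj.reachable (by simp [h, hxy])

lemma mem_vertexSet_of_reachable {F : Multiset (Sym2 X)} {x y : X}
    (hr : (SimpleGraph.fromEdgeSet {e | e ∈ F}).Reachable x y) (hx : x ∈ vertexSet F) :
    y ∈ vertexSet F := by
  obtain ⟨p⟩ := hr
  induction p with
  | nil => exact hx
  | @cons a b c h p ih =>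
    exact ih ⟨s(a, b), by simpa using h.1, by simp⟩

lemma walk_reachable {G : SimpleGraph X} {x y : X} (p : G.Walk x y) :
    ∀ v ∈ p.support,
      (SimpleGraph.fromEdgeSet {e | e ∈ (p.edges : Multiset (Sym2 X))}).Reachable v y := by
  induction p with
  | nil => simp
  | @cons a b c h p ih =>
    have hsub : (p.edges : Multiset (Sym2 X)) ⊆ ((p.cons h).edges : Multiset (Sym2 X)) := by
      intro e he; simp at he ⊢; exact Or.inr he
    intro v hv
    rw [SimpleGraph.Walk.support_cons, List.mem_cons] at hv
    rcases hv with rfl | hv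
    · exact (reachable_of_mem (by simp)).trans (reachable_mono hsub (ih b p.start_mem_support))
    · exact reachable_mono hsub (ih v hv)

lemma mem_support_of_mem_vertexSet {G : SimpleGraph X} {x y : X} (p : G.Walk x y) {v : X}
    (hv : v ∈ vertexSet (p.edges : Multiset (Sym2 X))) : v ∈ p.support := by
  obtain ⟨e, he, hve⟩ := hv
  exact p.mem_support_of_mem_edges (by simpa using he) hve

lemma not_isDiag_of_mem_edges {x y : X} (p : (⊤ : SimpleGraph X).Walk x y) :
    ∀ e ∈ (p.edges : Multiset (Sym2 X)), ¬ e.IsDiag := fun e he =>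
  SimpleGraph.not_isDiag_of_mem_edgeSet _ (p.edges_subset_edgeSet (by simpa using he))

lemma edges_ne_zero {G : SimpleGraph X} {x y : X} {p : G.Walk x y} (h : ¬ p.Nil) :
    (p.edges : Multiset (Sym2 X)) ≠ 0 := by
  cases p with
  | nil => simp at h
  | cons => simp

/-- In an edge multiset with even degrees, every edge lies on a closed walk through it that uses no
edge more often than it occurs: a longest walk cannot end anywhere but at its starting point. -/
lemma exists_closed_walk_le {G : Multiset (Sym2 X)} (hd : ∀ e ∈ G, ¬ e.IsDiag)
    (hb : boundary G = 0) {v w : X} (hvw : s(v, w) ∈ G) :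
    ∃ p : (⊤ : SimpleGraph X).Walk v v, ¬ p.Nil ∧ (p.edges : Multiset (Sym2 X)) ≤ G := by
  classical
  have key : ∀ (n : ℕ) (z : X) (p : (⊤ : SimpleGraph X).Walk v z), ¬ p.Nil →
      (p.edges : Multiset (Sym2 X)) ≤ G → Multiset.card G - p.length ≤ n →
      ∃ p : (⊤ : SimpleGraph X).Walk v v, ¬ p.Nil ∧ (p.edges : Multiset (Sym2 X)) ≤ G := by
    intro n
    induction n with
    | zero =>
      intro z p hp hle hn
      have hc := Multiset.card_le_card hle
      have : (p.edges : Multiset (Sym2 X)) = G :=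
        Multiset.eq_of_le_of_card_le hle (by simp; omega)
      by_cases hz : v = z
      · subst hz; exact ⟨p, hp, hle⟩
      · have h := boundary_edges p
        rw [this, hb] at h
        have := congrFun h z
        simp [Ne.symm hz] at this
    | succ n ih =>
      intro z p hp hle hn
      by_cases hz : v = z
      · subst hz; exact ⟨p, hp, hle⟩
      obtain ⟨H, rfl⟩ := Multiset.le_iff_exists_add.1 hle
      have hH : boundary H z ≠ 0 := by
        rw [boundary_add, boundary_edges] at hb
        have := congrFun hb z
        intro h0
        simp [Ne.symm hz, h0] at this
      obtain ⟨y, hy⟩ := exists_mem_of_boundary_ne_zero hH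
      have hne : z ≠ y := by simpa using hd s(z, y) (by simp [hy])
      have hsub : ((p.concat (show (⊤ : SimpleGraph X).Adj z y by simpa using hne)).edges :
          Multiset (Sym2 X)) ≤ p.edges + H := by
        rw [SimpleGraph.Walk.edges_concat, List.concat_eq_append, ← Multiset.coe_add]
        simpa using hy
      refine ih y _ ?_ hsub ?_
      · rw [← SimpleGraph.Walk.length_eq_zero_iff]; simp
      · have hc := Multiset.card_le_card hsub
        simp at hc hn ⊢
        omega
  have hne : v ≠ w := by simpa using hd _ hvw
  refine key _ w (SimpleGraph.Walk.cons (show (⊤ : SimpleGraph X).Adj v w by simpa using hne)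
    SimpleGraph.Walk.nil) (by simp) ?_ le_rfl
  simpa using hvw

/-- Euler's theorem: a connected edge multiset without self-loops all of whose degrees are even is
traversed by a closed walk. -/
theorem exists_circuit {F : Multiset (Sym2 X)} (h0 : F ≠ 0) (hd : ∀ e ∈ F, ¬ e.IsDiag)
    (hc : EdgeConnected F) (hb : boundary F = 0) :
    ∃ (v : X) (p : (⊤ : SimpleGraph X).Walk v v), ¬ p.Nil ∧
      (p.edges : Multiset (Sym2 X)) = F := by
  classical
  have key : ∀ (n : ℕ) (v : X) (p : (⊤ : SimpleGraph X).Walk v v), ¬ p.Nil →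
      (p.edges : Multiset (Sym2 X)) ≤ F → Multiset.card F - p.length ≤ n →
      ∃ (v : X) (p : (⊤ : SimpleGraph X).Walk v v), ¬ p.Nil ∧
        (p.edges : Multiset (Sym2 X)) = F := by
    intro n
    induction n with
    | zero =>
      intro v p hp hle hn
      refine ⟨v, p, hp, Multiset.eq_of_le_of_card_le hle ?_⟩
      simp; omega
    | succ n ih =>
      intro v p hp hle hn
      obtain ⟨G, hG⟩ := Multiset.le_iff_exists_add.1 hle
      by_cases hG0 : G = 0
      · exact ⟨v, p, hp, by rw [hG, hG0, add_zero]⟩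
      have hbG : boundary G = 0 := by
        rw [hG, boundary_add, boundary_edges] at hb
        funext z
        have h1 := congrFun hb z
        simpa [CharTwo.add_self_eq_zero] using h1
      -- some edge left over touches the walk, by connectedness
      have htouch : ∃ x ∈ p.support, ∃ y, s(x, y) ∈ G := by
        by_contra! hno
        obtain ⟨e, he⟩ := Multiset.exists_mem_of_ne_zero hG0
        induction e with | _ a b
        have ha : a ∉ p.support := fun h => hno a h b he
        have hvF : v ∈ vertexSet F := by
          cases p with
          | nil => simp at hp
          | @cons _ w _ h q =>
            exact ⟨s(v, w), by rw [hG]; simp, by simp⟩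
        have haF : a ∈ vertexSet F := ⟨s(a, b), by rw [hG]; simp [he], by simp⟩
        obtain ⟨q⟩ := hc v hvF a haF
        obtain ⟨d, hdq, hd1, hd2⟩ := q.exists_boundary_dart {x | x ∈ p.support}
          (by simp) ha
        have hadj : s(d.fst, d.snd) ∈ F := by
          have := d.adj
          rw [SimpleGraph.fromEdgeSet_adj] at this
          exact this.1
        rcases Multiset.mem_add.1 (Multiset.mem_of_le hG.le hadj) with h | h
        · exact hd2 (p.snd_mem_support_of_mem_edges (by simpa using h))
        · exact hno _ hd1 _ h
      obtain ⟨x, hx, y, hxy⟩ := htouch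
      obtain ⟨q, hq, hqle⟩ := exists_closed_walk_le
        (fun e he => hd e (by rw [hG]; simp [he])) hbG hxy
      have hrot : ((p.rotate x hx).edges : Multiset (Sym2 X)) = p.edges :=
        Multiset.coe_eq_coe.2 (p.rotate_edges x hx).perm
      have hle' : (((p.rotate x hx).append q).edges : Multiset (Sym2 X)) ≤ F := by
        rw [SimpleGraph.Walk.edges_append, ← Multiset.coe_add, hrot, hG]
        gcongr
      have hlen : (p.rotate x hx).length = p.length := by
        rw [← SimpleGraph.Walk.length_edges, ← SimpleGraph.Walk.length_edges]
        exact (p.rotate_edges x hx).perm.length_eq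
      have hq1 : 0 < q.length := by
        rw [← SimpleGraph.Walk.length_eq_zero_iff] at hq; omega
      have hc' := Multiset.card_le_card hle'
      refine ih x _ ?_ hle' ?_
      · rw [← SimpleGraph.Walk.length_eq_zero_iff]; rw [SimpleGraph.Walk.length_append]; omega
      · simp [hlen] at hc' ⊢
        omega
  obtain ⟨e, he⟩ := Multiset.exists_mem_of_ne_zero h0
  induction e with | _ a b
  obtain ⟨p, hp, hle⟩ := exists_closed_walk_le hd hb he
  exact key _ a p hp hle le_rfl

/-- A feasible solution other than a single self-loop is a nonempty connected edge multiset without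
self-loops, which for the travelling salesman has even degrees; and conversely. -/
lemma isSolution_iff (P : Problem) (F : Multiset (Sym2 X)) :
    IsSolution P F ↔ (∃ x : X, F = {s(x, x)}) ∨
      (F ≠ 0 ∧ (∀ e ∈ F, ¬ e.IsDiag) ∧ EdgeConnected F ∧ (P = .tsp → boundary F = 0)) := by
  classical
  cases P with
  | stp => simp [IsSolution, EdgeConnected]
  | tsp =>
    refine or_congr_right ⟨?_, ?_⟩
    · rintro ⟨v, p, hp, rfl⟩
      refine ⟨edges_ne_zero hp, not_isDiag_of_mem_edges p, fun x hx y hy => ?_, fun _ => ?_⟩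
      · exact (walk_reachable p x (mem_support_of_mem_vertexSet p hx)).trans
          (walk_reachable p y (mem_support_of_mem_vertexSet p hy)).symm
      · rw [boundary_edges]; funext z; exact CharTwo.add_self_eq_zero _
    · rintro ⟨h0, hd, hc, hb⟩
      exact exists_circuit h0 hd hc (hb rfl)

end

/-! ### Hierarchical nets in doubling spaces: packing bounds and net-respecting walks -/

section
variable {X : Type*} [MetricSpace X]

@[simp] lemma edgeLength_mk (x y : X) : edgeLength s(x, y) = dist x y := rfl

lemma edgeLength_nonneg (e : Sym2 X) : 0 ≤ edgeLength e := by
  induction e with | _ a b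
  simp

@[simp] lemma weight_zero : weight (0 : Multiset (Sym2 X)) = 0 := by simp [weight]

lemma weight_add (F G : Multiset (Sym2 X)) : weight (F + G) = weight F + weight G := by
  simp [weight]

@[simp] lemma weight_cons (e : Sym2 X) (F : Multiset (Sym2 X)) :
    weight (e ::ₘ F) = edgeLength e + weight F := by
  simp [weight]

lemma weight_nonneg (F : Multiset (Sym2 X)) : 0 ≤ weight F :=
  Multiset.sum_nonneg fun x hx => by
    obtain ⟨e, -, rfl⟩ := Multiset.mem_map.1 hx
    exact edgeLength_nonneg e

lemma dist_le_weight_edges {G : SimpleGraph X} {x y : X} (p : G.Walk x y) :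
    dist x y ≤ weight (p.edges : Multiset (Sym2 X)) := by
  induction p with
  | nil => simp
  | @cons a b c h p ih =>
    rw [SimpleGraph.Walk.edges_cons, ← Multiset.cons_coe, weight_cons, edgeLength_mk]
    linarith [dist_triangle a b c]

variable {s ε k : ℝ} {N : ℤ → Set X}

lemma NetRespecting.mono {F G : Multiset (Sym2 X)} (h : NetRespecting s ε N G) (hs : F ⊆ G) :
    NetRespecting s ε N F := fun x y hxy => h x y (hs hxy)

lemma NetRespecting.add {F G : Multiset (Sym2 X)} (hF : NetRespecting s ε N F)
    (hG : NetRespecting s ε N G) : NetRespecting s ε N (F + G) := fun x y hxy =>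
  (Multiset.mem_add.1 hxy).elim (hF x y) (hG x y)

lemma NetRespecting.zero : NetRespecting s ε N 0 := fun x y h => by simp at h

/-- Some net-respecting walk from `x` to `y` has weight at most `c`. -/
def NRJoin (s ε : ℝ) (N : ℤ → Set X) (x y : X) (c : ℝ) : Prop :=
  ∃ p : (⊤ : SimpleGraph X).Walk x y,
    NetRespecting s ε N (p.edges : Multiset (Sym2 X)) ∧
      weight (p.edges : Multiset (Sym2 X)) ≤ c

lemma NRJoin.refl (x : X) {c : ℝ} (hc : 0 ≤ c) : NRJoin s ε N x x c :=
  ⟨.nil, by simpa using NetRespecting.zero, by simpa using hc⟩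

lemma NRJoin.symm {x y : X} {c : ℝ} (h : NRJoin s ε N x y c) : NRJoin s ε N y x c := by
  obtain ⟨p, h1, h2⟩ := h
  refine ⟨p.reverse, ?_, ?_⟩ <;>
    rwa [SimpleGraph.Walk.edges_reverse, Multiset.coe_reverse]

lemma NRJoin.trans {x y z : X} {c d : ℝ} (h : NRJoin s ε N x y c) (h' : NRJoin s ε N y z d) :
    NRJoin s ε N x z (c + d) := by
  obtain ⟨p, h1, h2⟩ := h
  obtain ⟨q, h3, h4⟩ := h'
  refine ⟨p.append q, ?_, ?_⟩ <;> rw [SimpleGraph.Walk.edges_append, ← Multiset.coe_add]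
  · exact h1.add h3
  · rw [weight_add]; linarith

lemma NRJoin.mono {x y : X} {c d : ℝ} (h : NRJoin s ε N x y c) (hcd : c ≤ d) :
    NRJoin s ε N x y d := by
  obtain ⟨p, h1, h2⟩ := h
  exact ⟨p, h1, h2.trans hcd⟩

lemma NRJoin.dist_le {x y : X} {c : ℝ} (h : NRJoin s ε N x y c) : dist x y ≤ c := by
  obtain ⟨p, -, h2⟩ := h
  exact (dist_le_weight_edges p).trans h2

lemma IsHierarchicalNet.antitone (hN : IsHierarchicalNet s N) : Antitone N := by
  refine antitone_int_of_succ_le fun i => ?_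
  rcases le_or_gt 1 (i + 1) with h | h
  · simpa using (hN.isNet (i + 1) h).subset
  · rw [hN.eq_univ i (by omega)]; exact Set.subset_univ _

/-- A single edge between points of `N j` is net-respecting if `ε` times its length is below
`s ^ (j + 1)`. -/
lemma NRJoin.edge (hs : 4 ≤ s) (hN : IsHierarchicalNet s N) {x y : X} {j : ℤ}
    (hx : x ∈ N j) (hy : y ∈ N j) (hd : ε * dist x y < s ^ (j + 1)) :
    NRJoin s ε N x y (dist x y) := by
  by_cases hxy : x = y
  · subst hxy; exact NRJoin.refl x dist_nonneg
  refine ⟨.cons (show (⊤ : SimpleGraph X).Adj x y by simpa using hxy) .nil, ?_, by simp [weight]⟩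
  have key : ∀ i : ℤ, s ^ i ≤ ε * dist x y → i ≤ j := fun i hi => by
    have := (zpow_lt_zpow_iff_right₀ (by linarith : 1 < s)).1 (hi.trans_lt hd)
    omega
  intro a b hab i h1 _
  simp only [SimpleGraph.Walk.edges_cons, SimpleGraph.Walk.edges_nil, Multiset.coe_singleton,
    Multiset.mem_singleton, Sym2.eq_iff] at hab
  rcases hab with ⟨rfl, rfl⟩ | ⟨rfl, rfl⟩
  · have := hN.antitone (key i h1)
    exact ⟨this hx, this hy⟩
  · have := hN.antitone (key i (by rwa [dist_comm]))
    exact ⟨this hy, this hx⟩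

/-- Climbing through the nets, `x ∈ N 0`, then `N 1`, `N 2`, …, is net-respecting, and the lengths
of the steps form a geometric series. -/
lemma exists_climb (hs : 4 ≤ s) (hε : 0 < ε) (hε1 : ε < 1) (hN : IsHierarchicalNet s N)
    (x : X) (j : ℤ) : ∃ y ∈ N j, NRJoin s ε N x y (4 / 3 * s ^ j) := by
  have hs0 : 0 < s := by linarith
  rcases le_or_gt j 0 with hj | hj
  · exact ⟨x, by rw [hN.eq_univ j hj]; trivial, NRJoin.refl x (by positivity)⟩
  · obtain ⟨n, rfl⟩ := Int.eq_ofNat_of_zero_le hj.le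
    clear hj
    induction n with
    | zero => exact ⟨x, by rw [hN.eq_univ ((0 : ℕ) : ℤ) (by simp)]; trivial,
        NRJoin.refl x (by positivity)⟩
    | succ n ih =>
      obtain ⟨y, hy, hxy⟩ := ih
      have hnet := hN.isNet ((n : ℤ) + 1) (by omega)
      rw [add_sub_cancel_right] at hnet
      obtain ⟨z, hz, hd⟩ := hnet.cover y hy
      have hp : (0 : ℝ) < s ^ ((n : ℤ) + 1) := by positivity
      rw [dist_comm] at hd
      have hlt : ε * dist y z < s ^ ((n : ℤ) + 1) := by
        nlinarith [dist_nonneg (x := y) (y := z)]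
      refine ⟨z, by exact_mod_cast hz,
        (hxy.trans (NRJoin.edge hs hN hy (hnet.subset hz) hlt)).mono ?_⟩
      have he : s ^ ((n : ℤ) + 1) = s ^ (n : ℤ) * s := zpow_add_one₀ hs0.ne' _
      have hp' : (0 : ℝ) < s ^ (n : ℤ) := by positivity
      push_cast at *
      nlinarith

/-- Any two points at distance at most `R` are joined by a net-respecting walk of weight `O(sR)`:
climb to the level just above `R`, where a direct edge is allowed. -/
lemma nrJoin_of_dist_le (hs : 4 ≤ s) (hε : 0 < ε) (hε1 : ε < 1) (hN : IsHierarchicalNet s N)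
    {x y : X} {R : ℝ} (hR : 0 < R) (hxy : dist x y ≤ R) : NRJoin s ε N x y (7 * (s * R)) := by
  have hs0 : 0 < s := by linarith
  obtain ⟨j, hj1, hj2⟩ := exists_mem_Ico_zpow hR (by linarith : 1 < s)
  obtain ⟨x', hx', hxx⟩ := exists_climb hs hε hε1 hN x (j + 1)
  obtain ⟨y', hy', hyy⟩ := exists_climb hs hε hε1 hN y (j + 1)
  have he : s ^ (j + 1) = s ^ j * s := zpow_add_one₀ hs0.ne' _
  have he' : s ^ (j + 1 + 1) = s ^ (j + 1) * s := zpow_add_one₀ hs0.ne' _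
  have hp : 0 < s ^ (j + 1) := by positivity
  have hd : dist x' y' ≤ R + 8 / 3 * s ^ (j + 1) := by
    have h1 := hxx.dist_le
    have h2 := hyy.dist_le
    rw [dist_comm] at h1
    linarith [dist_triangle x' x y', dist_triangle x y y']
  have hlt : ε * dist x' y' < s ^ (j + 1 + 1) := by
    have : ε * dist x' y' ≤ dist x' y' :=
      mul_le_of_le_one_left dist_nonneg hε1.le
    nlinarith
  refine ((hxx.trans (NRJoin.edge hs hN hx' hy' hlt)).trans hyy.symm).mono ?_
  nlinarith

lemma IsHierarchicalNet.le_dist (hs : 4 ≤ s) (hN : IsHierarchicalNet s N)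
    (hX : ∀ x y : X, x ≠ y → 1 ≤ dist x y) {j : ℤ} {x y : X} (hx : x ∈ N j) (hy : y ∈ N j)
    (hxy : x ≠ y) : s ^ j ≤ dist x y := by
  rcases le_or_gt 1 j with h | h
  · exact ((hN.isNet j h).packing x hx y hy hxy).le
  · exact (zpow_le_one_of_nonpos₀ (by linarith) (by omega)).trans (hX x y hxy)

lemma DoublingDimLE.exists_cover_pow (hX : DoublingDimLE X k) (x : X) {ρ : ℝ} (hρ : 0 < ρ)
    (M : ℕ) : ∃ Z : Finset X, (Z.card : ℝ) ≤ ((2 : ℝ) ^ k) ^ M ∧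
      Metric.closedBall x (2 ^ M * ρ) ⊆ ⋃ z ∈ Z, Metric.closedBall z ρ := by
  classical
  induction M generalizing x with
  | zero => exact ⟨{x}, by simp⟩
  | succ M ih =>
    obtain ⟨Y, hYc, hY⟩ := hX x (2 ^ M * ρ) (by positivity)
    choose Z hZc hZ using ih
    refine ⟨Y.biUnion Z, ?_, ?_⟩
    · calc ((Y.biUnion Z).card : ℝ) ≤ ∑ y ∈ Y, ((Z y).card : ℝ) := by
            exact_mod_cast Finset.card_biUnion_le
        _ ≤ ∑ y ∈ Y, ((2 : ℝ) ^ k) ^ M := Finset.sum_le_sum fun y _ => hZc y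
        _ = Y.card * ((2 : ℝ) ^ k) ^ M := by rw [Finset.sum_const, nsmul_eq_mul]
        _ ≤ ((2 : ℝ) ^ k) ^ (M + 1) := by rw [pow_succ']; gcongr
    · intro v hv
      rw [pow_succ', mul_assoc] at hv
      obtain ⟨y, hy, hvy⟩ := Set.mem_iUnion₂.1 (hY hv)
      obtain ⟨z, hz, hvz⟩ := Set.mem_iUnion₂.1 (hZ y hvy)
      exact Set.mem_iUnion₂.2 ⟨z, Finset.mem_biUnion.2 ⟨y, hy, hz⟩, hvz⟩

/-- A finite metric space with two points has doubling dimension at least one: around a closest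
pair, the ball of radius equal to its distance needs two balls of half that radius. -/
lemma DoublingDimLE.one_le [Finite X] [Nontrivial X] (hX : DoublingDimLE X k) : 1 ≤ k := by
  obtain ⟨a, b, hab⟩ := exists_pair_ne X
  obtain ⟨⟨x, y⟩, hxy, hmin⟩ := Set.exists_min_image {p : X × X | p.1 ≠ p.2}
    (fun p => dist p.1 p.2) (Set.toFinite _) ⟨(a, b), hab⟩
  have hxy : x ≠ y := hxy
  have hd : 0 < dist x y := dist_pos.2 hxy
  obtain ⟨Z, hZ, hcov⟩ := hX x (dist x y / 2) (by positivity)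
  have hclose : ∀ z w : X, dist w z ≤ dist x y / 2 → w = z := fun z w h => by
    by_contra hne
    have := hmin (w, z) hne
    simp only at this
    linarith
  have hx : x ∈ Z := by
    have := hcov (show x ∈ Metric.closedBall x (2 * (dist x y / 2)) by simp; positivity)
    simp only [Set.mem_iUnion, Metric.mem_closedBall] at this
    obtain ⟨z, hz, h⟩ := this
    rwa [hclose z x h]
  have hy : y ∈ Z := by
    have := hcov (show y ∈ Metric.closedBall x (2 * (dist x y / 2)) by
      simp only [Metric.mem_closedBall]; rw [dist_comm]; linarith)
    simp only [Set.mem_iUnion, Metric.mem_closedBall] at this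
    obtain ⟨z, hz, h⟩ := this
    rwa [hclose z y h]
  have h2 : (2 : ℝ) ≤ Z.card := by
    exact_mod_cast Finset.one_lt_card.2 ⟨x, hx, y, hy, hxy⟩
  have : (2 : ℝ) ^ (1 : ℝ) ≤ (2 : ℝ) ^ k := by rw [Real.rpow_one]; linarith
  exact (Real.rpow_le_rpow_left_iff (by norm_num)).1 this

/-- The packing bound for the net points of height `j` in a ball. -/
lemma card_net_le (hX : DoublingDimLE X k) (hk : 0 ≤ k) (hs : 4 ≤ s)
    (hN : IsHierarchicalNet s N) (hX1 : ∀ x y : X, x ≠ y → 1 ≤ dist x y) {j : ℤ} {u : X} {R : ℝ}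
    (hR : s ^ j ≤ R) {P : Finset X} (hP : ∀ p ∈ P, p ∈ N j ∧ p ∈ Metric.closedBall u R) :
    (P.card : ℝ) ≤ (8 * R / s ^ j) ^ k := by
  classical
  have hs0 : 0 < s := by linarith
  have hp : 0 < s ^ j := by positivity
  have hρ : 0 < s ^ j / 4 := by positivity
  obtain ⟨M, hM1, hM2⟩ : ∃ M : ℕ, R ≤ 2 ^ M * (s ^ j / 4) ∧ (2 : ℝ) ^ M ≤ 8 * R / s ^ j := by
    have h1 : 1 ≤ R / (s ^ j / 4) := by rw [le_div_iff₀ hρ]; linarith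
    obtain ⟨M, hM1, hM2⟩ := exists_nat_pow_near h1 (by norm_num : (1 : ℝ) < 2)
    refine ⟨M + 1, ?_, ?_⟩
    · rw [div_lt_iff₀ hρ] at hM2; exact hM2.le
    · rw [le_div_iff₀ hρ] at hM1
      rw [le_div_iff₀ hp, pow_succ]; linarith
  obtain ⟨Z, hZc, hZ⟩ := hX.exists_cover_pow u hρ M
  have hex : ∀ p : X, ∃ z, p ∈ P → z ∈ Z ∧ dist p z ≤ s ^ j / 4 := fun p => by
    by_cases h : p ∈ P
    · have := hZ (Metric.closedBall_subset_closedBall hM1 (hP p h).2)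
      simp only [Set.mem_iUnion, Metric.mem_closedBall] at this
      obtain ⟨z, hz, hd⟩ := this
      exact ⟨z, fun _ => ⟨hz, hd⟩⟩
    · exact ⟨p, fun h' => absurd h' h⟩
  choose f hf using hex
  have hcard : P.card ≤ Z.card := by
    refine Finset.card_le_card_of_injOn f (fun p hp => (hf p hp).1) fun p hp q hq hpq => ?_
    by_contra hne
    have h1 := hN.le_dist hs hX1 (hP p hp).1 (hP q hq).1 hne
    have h2 := (hf p hp).2
    have h3 := (hf q hq).2
    rw [← hpq, dist_comm] at h3
    linarith [dist_triangle p (f p) q]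
  calc (P.card : ℝ) ≤ Z.card := by exact_mod_cast hcard
    _ ≤ ((2 : ℝ) ^ k) ^ M := hZc
    _ = ((2 : ℝ) ^ M) ^ k := by
      rw [← Real.rpow_natCast, ← Real.rpow_mul (by norm_num), mul_comm,
        Real.rpow_mul (by norm_num), Real.rpow_natCast]
    _ ≤ _ := Real.rpow_le_rpow (by positivity) hM2 hk

end

/-! ### Replacing the part of a solution inside a ball -/

section
variable {X : Type*}

lemma boundary_sum {ι : Type*} (Y : Finset ι) (f : ι → Multiset (Sym2 X)) :
    boundary (∑ y ∈ Y, f y) = ∑ y ∈ Y, boundary (f y) := by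
  classical
  induction Y using Finset.induction_on with
  | empty => simp
  | insert a Y ha ih => rw [Finset.sum_insert ha, Finset.sum_insert ha, boundary_add, ih]

lemma mem_restrict {F : Multiset (Sym2 X)} {S : Set X} {e : Sym2 X} :
    e ∈ restrict F S ↔ e ∈ F ∧ ∀ x ∈ e, x ∈ S := by
  classical
  exact Multiset.mem_filter

/-- A walk in `F` that ends in `S`, followed up to its first visit of `S`, uses only edges with an
endpoint outside `S`. -/
lemma exists_reachable_of_walk {F G : Multiset (Sym2 X)} {S : Set X}
    (hG : ∀ e ∈ F, ∀ x ∈ e, x ∉ S → e ∈ G) {v a : X}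
    (p : (SimpleGraph.fromEdgeSet {e | e ∈ F}).Walk v a) (ha : a ∈ S) :
    ∃ z ∈ S, (SimpleGraph.fromEdgeSet {e | e ∈ G}).Reachable v z := by
  induction p with
  | nil => exact ⟨_, ha, .rfl⟩
  | @cons v w a h p ih =>
    by_cases hv : v ∈ S
    · exact ⟨v, hv, .rfl⟩
    · obtain ⟨z, hz, hr⟩ := ih ha
      rw [SimpleGraph.fromEdgeSet_adj] at h
      exact ⟨z, hz, (reachable_of_mem (hG _ h.1 v (by simp) hv)).trans hr⟩

end

section
variable {X : Type*} [MetricSpace X] {s ε k : ℝ} {N : ℤ → Set X}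

lemma weight_sum {ι : Type*} (Y : Finset ι) (f : ι → Multiset (Sym2 X)) :
    weight (∑ y ∈ Y, f y) = ∑ y ∈ Y, weight (f y) := by
  classical
  induction Y using Finset.induction_on with
  | empty => simp
  | insert a Y ha ih => rw [Finset.sum_insert ha, Finset.sum_insert ha, weight_add, ih]

/-- Each point `y` of `Y` can be linked to its target `q y` by one or two copies of a
net-respecting walk, the number of copies being chosen so that all points of `Y` get even degree. -/
lemma exists_connector (G : Multiset (Sym2 X)) (Y : Finset X) (q : X → X) (c : ℝ)
    (hq : ∀ y ∈ Y, q y ∉ Y) (hj : ∀ y ∈ Y, NRJoin s ε N y (q y) c) :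
    ∃ D : Multiset (Sym2 X), NetRespecting s ε N D ∧ (∀ e ∈ D, ¬ e.IsDiag) ∧
      weight D ≤ 2 * (Y.card * c) ∧
      (∀ v ∈ vertexSet D, ∃ y ∈ Y,
        (SimpleGraph.fromEdgeSet {e | e ∈ D}).Reachable v (q y)) ∧
      (∀ y ∈ Y, (SimpleGraph.fromEdgeSet {e | e ∈ D}).Reachable y (q y)) ∧
      ∀ v, boundary (G + D) v ≠ 0 → v ∉ Y ∧ (boundary G v ≠ 0 ∨ ∃ y ∈ Y, v = q y) := by
  classical
  have hex : ∀ y : X, ∃ p : (⊤ : SimpleGraph X).Walk y (if y ∈ Y then q y else y), y ∈ Y →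
      NetRespecting s ε N (p.edges : Multiset (Sym2 X)) ∧
        weight (p.edges : Multiset (Sym2 X)) ≤ c := by
    intro y
    by_cases hy : y ∈ Y
    · rw [if_pos hy]
      obtain ⟨p, hp⟩ := hj y hy
      exact ⟨p, fun _ => hp⟩
    · rw [if_neg hy]
      exact ⟨.nil, fun h => absurd h hy⟩
  choose p hp using hex
  let E : X → Multiset (Sym2 X) := fun y =>
    if boundary G y = 0 then (p y).edges + (p y).edges else (p y).edges
  have hE : ∀ y e, e ∈ E y ↔ e ∈ ((p y).edges : Multiset (Sym2 X)) := by
    intro y e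
    by_cases h : boundary G y = 0 <;> simp [E, h]
  have hmem : ∀ e, e ∈ ∑ y ∈ Y, E y ↔ ∃ y ∈ Y, e ∈ ((p y).edges : Multiset (Sym2 X)) := by
    intro e
    simp only [Multiset.mem_sum, hE]
  have hsub : ∀ y ∈ Y, ((p y).edges : Multiset (Sym2 X)) ⊆ ∑ y ∈ Y, E y :=
    fun y hy e he => (hmem e).2 ⟨y, hy, he⟩
  have hz : ∀ y ∈ Y, (if y ∈ Y then q y else y) = q y := fun y hy => if_pos hy
  refine ⟨∑ y ∈ Y, E y, ?_, ?_, ?_, ?_, ?_, ?_⟩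
  · intro a b hab
    obtain ⟨y, hy, he⟩ := (hmem _).1 hab
    exact (hp y hy).1 a b he
  · intro e he
    obtain ⟨y, hy, he⟩ := (hmem _).1 he
    exact not_isDiag_of_mem_edges _ e he
  · rw [weight_sum]
    have : ∀ y ∈ Y, weight (E y) ≤ 2 * c := fun y hy => by
      have h1 := (hp y hy).2
      have h0 := weight_nonneg ((p y).edges : Multiset (Sym2 X))
      by_cases h : boundary G y = 0
      · simp only [E, h, if_true, weight_add]; linarith
      · simp only [E, h, if_false]; linarith
    calc _ ≤ ∑ y ∈ Y, 2 * c := Finset.sum_le_sum this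
      _ = _ := by rw [Finset.sum_const, nsmul_eq_mul]; ring
  · rintro v ⟨e, he, hv⟩
    obtain ⟨y, hy, he⟩ := (hmem _).1 he
    have := reachable_mono (hsub y hy)
      (walk_reachable (p y) v (mem_support_of_mem_vertexSet _ ⟨e, he, hv⟩))
    rw [hz y hy] at this
    exact ⟨y, hy, this⟩
  · intro y hy
    have := reachable_mono (hsub y hy) (walk_reachable (p y) y (p y).start_mem_support)
    rwa [hz y hy] at this
  · have hbE : ∀ y ∈ Y, ∀ v, boundary (E y) v =
        boundary G y * ((if v = y then 1 else 0) + (if v = q y then 1 else 0)) := by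
      intro y hy v
      have h01 : boundary G y = 0 ∨ boundary G y = 1 := by
        generalize boundary G y = b
        revert b; decide
      rcases h01 with h | h
      · simp only [E, h, if_true, boundary_add_self]; simp
      · simp only [E, h, one_ne_zero, if_false, boundary_edges, hz y hy, Pi.add_apply,
          Pi.single_apply, one_mul]
    intro v hv
    have hval : boundary (G + ∑ y ∈ Y, E y) v = boundary G v + ∑ y ∈ Y,
        boundary G y * ((if v = y then 1 else 0) + (if v = q y then 1 else 0)) := by
      rw [boundary_add, boundary_sum, Pi.add_apply, Finset.sum_apply,
        Finset.sum_congr rfl fun y hy => hbE y hy v]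
    rw [hval] at hv
    by_cases hvY : v ∈ Y
    · exfalso
      apply hv
      have : ∀ y ∈ Y, boundary G y * ((if v = y then 1 else 0) + (if v = q y then 1 else 0)) =
          if v = y then boundary G y else 0 := by
        intro y hy
        have : v ≠ q y := by rintro rfl; exact hq y hy hvY
        simp [this]
      rw [Finset.sum_congr rfl this, Finset.sum_ite_eq, if_pos hvY]
      exact CharTwo.add_self_eq_zero _
    · refine ⟨hvY, ?_⟩
      by_contra! hno
      apply hv
      rw [hno.1, zero_add]
      refine Finset.sum_eq_zero fun y hy => ?_
      have : v ≠ y := by rintro rfl; exact hvY hy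
      simp [this, hno.2 y hy]

/-- Penalties that a replacement `F''` pays are paid by `F` or by the local solution `F'`. -/
lemma cost_le_of_vertexSet (W : Instance X) {F F' F'' : Multiset (Sym2 X)} {u : X} {ρ : ℝ}
    (h : ∀ v, v ∉ vertexSet F'' → v ∉ vertexSet F ∨
      (v ∈ Metric.closedBall u ρ ∧ v ∉ vertexSet F')) :
    cost W F'' - weight F'' ≤ (cost W F - weight F) + (cost (W.subBall u ρ) F' - weight F') := by
  classical
  simp only [cost, add_sub_cancel_left, Instance.subBall]
  have hnn : ∀ A : Finset X, 0 ≤ ∑ v ∈ A, (W.penalty v : ℝ) := fun A =>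
    Finset.sum_nonneg fun v _ => NNReal.coe_nonneg _
  rw [← Finset.sum_union_inter]
  refine le_add_of_le_of_nonneg
    (Finset.sum_le_sum_of_subset_of_nonneg ?_ fun _ _ _ => NNReal.coe_nonneg _) (hnn _)
  intro v hv
  simp only [Finset.mem_filter, Finset.mem_union] at hv ⊢
  rcases h v hv.2 with h | h
  · exact Or.inl ⟨hv.1, h⟩
  · exact Or.inr ⟨⟨hv.1, h.1⟩, h.2⟩

open Classical in
/-- The edges of `F`, with multiplicity, of length less than `ℓ` with exactly one endpoint
in `S`. -/
noncomputable def crossing (F : Multiset (Sym2 X)) (S : Set X) (ℓ : ℝ) : Multiset (Sym2 X) :=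
  F.filter fun e => edgeLength e < ℓ ∧ ∃ a ∈ S, ∃ b ∉ S, e = s(a, b)

lemma mem_crossing {F : Multiset (Sym2 X)} {S : Set X} {ℓ : ℝ} {e : Sym2 X} :
    e ∈ crossing F S ℓ ↔ e ∈ F ∧ edgeLength e < ℓ ∧ ∃ a ∈ S, ∃ b ∉ S, e = s(a, b) := by
  classical
  exact Multiset.mem_filter

/-- The part of a local solution that is added to a global one, attached to `u`: nothing if it does
not meet the ball, and only a connection to `u` if it is a single self-loop. -/
lemma exists_attached {P : Problem} (hs : 4 ≤ s) (hε : 0 < ε) (hε1 : ε < 1)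
    (hN : IsHierarchicalNet s N) {F' : Multiset (Sym2 X)} (hF' : IsSolution P F')
    (hNR : NetRespecting s ε N F') (u : X) {ρ : ℝ} (hρ : 0 < ρ) :
    ∃ A : Multiset (Sym2 X), NetRespecting s ε N A ∧ (∀ e ∈ A, ¬ e.IsDiag) ∧
      (P = .tsp → boundary A = 0) ∧ weight A ≤ weight F' + 14 * (s * ρ) ∧
      (∀ v ∈ vertexSet A, (SimpleGraph.fromEdgeSet {e | e ∈ A}).Reachable v u) ∧
      ∀ v ∈ vertexSet F', v ∈ Metric.closedBall u ρ →
        (SimpleGraph.fromEdgeSet {e | e ∈ A}).Reachable v u := by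
  have hs0 : 0 < s := by linarith
  by_cases hmeet : ∃ x ∈ vertexSet F', x ∈ Metric.closedBall u ρ
  swap
  · refine ⟨0, NetRespecting.zero, by simp, fun _ => boundary_zero, ?_, ?_, ?_⟩
    · have := weight_nonneg F'
      rw [weight_zero]; positivity
    · rintro v ⟨e, he, -⟩; simp at he
    · exact fun v hv hvb => absurd ⟨v, hv, hvb⟩ hmeet
  obtain ⟨x, hx, hxb⟩ := hmeet
  obtain ⟨p, hpN, hpw⟩ := nrJoin_of_dist_le hs hε hε1 hN hρ (Metric.mem_closedBall.1 hxb)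
  have hpv : ∀ v ∈ p.support,
      (SimpleGraph.fromEdgeSet {e | e ∈ (p.edges + p.edges : Multiset (Sym2 X))}).Reachable v u :=
    fun v hv => reachable_mono (fun e he => by simp at he ⊢; exact he) (walk_reachable p v hv)
  have hpV : ∀ v ∈ vertexSet (p.edges + p.edges : Multiset (Sym2 X)), v ∈ p.support := by
    intro v hv
    rw [vertexSet_add, Set.union_self] at hv
    exact mem_support_of_mem_vertexSet p hv
  have hpd : ∀ e ∈ (p.edges + p.edges : Multiset (Sym2 X)), ¬ e.IsDiag := fun e he =>
    not_isDiag_of_mem_edges p e (by simpa using he)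
  rcases (isSolution_iff P F').1 hF' with ⟨y, rfl⟩ | ⟨h0, hd, hc, hb⟩
  · refine ⟨p.edges + p.edges, hpN.add hpN, hpd, fun _ => boundary_add_self _, ?_,
      fun v hv => hpv v (hpV v hv), fun v hv _ => ?_⟩
    · have := weight_nonneg ({s(y, y)} : Multiset (Sym2 X))
      rw [weight_add]; linarith
    · simp only [vertexSet, Multiset.mem_singleton, exists_eq_left, Sym2.mem_iff, or_self,
        Set.mem_ofPred_eq] at hv hx
      rw [hv, ← hx]
      exact hpv x p.start_mem_support
  · have h1 : ∀ v ∈ vertexSet F', (SimpleGraph.fromEdgeSet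
        {e | e ∈ F' + (p.edges + p.edges : Multiset (Sym2 X))}).Reachable v u := fun v hv =>
      (reachable_mono (Multiset.subset_of_le (Multiset.le_add_right _ _)) (hc v hv x hx)).trans
        (reachable_mono (Multiset.subset_of_le (Multiset.le_add_left _ _))
          (hpv x p.start_mem_support))
    refine ⟨F' + (p.edges + p.edges), hNR.add (hpN.add hpN), ?_, fun h => ?_, ?_, ?_,
      fun v hv _ => h1 v hv⟩
    · intro e he
      exact (Multiset.mem_add.1 he).elim (hd e) (hpd e)
    · rw [boundary_add, boundary_add_self, hb h, add_zero]
    · rw [weight_add, weight_add]; linarith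
    · intro v hv
      rw [vertexSet_add] at hv
      rcases hv with hv | hv
      · exact h1 v hv
      · exact reachable_mono (Multiset.subset_of_le (Multiset.le_add_left _ _)) (hpv v (hpV v hv))

/-- The exchange inequality: the part of an optimal solution in a ball of radius `r` weighs at most
the cost of a local solution, plus the weight of connecting, through the net of height `j`, the
points where the solution crosses the sphere. Long crossing edges end at net points, of which
there are few, so that only the short ones need to be counted. -/
theorem weight_restrict_le [Finite X] {P : Problem} (hs : 4 ≤ s) (hε : 0 < ε) (hε1 : ε < 1)
    (hN : IsHierarchicalNet s N) {W : Instance X} {F F' : Multiset (Sym2 X)}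
    (hopt : IsOptimalNR P s ε N W F) (hloop : ∀ x : X, F ≠ {s(x, x)})
    (hF' : IsSolution P F') (hNR' : NetRespecting s ε N F')
    {u : X} {r ρ R : ℝ} {j : ℤ} (hu : u ∈ N j) (hrρ : r ≤ ρ) (hρ : 0 < ρ)
    (hρR : ρ + 4 / 3 * s ^ j ≤ R) (hne : restrict F (Metric.closedBall u r) ≠ 0)
    {Q : Finset X} (hQ : ∀ p, p ∈ Q ↔ p ∈ N j ∧ p ∈ Metric.closedBall u R) :
    weight (restrict F (Metric.closedBall u r)) ≤ cost (W.subBall u ρ) F' +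
      (8 / 3 * s ^ j * Multiset.card (crossing F (Metric.closedBall u r) (s ^ j / ε)) +
        14 * (s * R) * Q.card) := by
  classical
  have hs0 : 0 < s := by linarith
  have hsj : 0 < s ^ j := by positivity
  have hR0 : 0 < R := by linarith
  obtain ⟨hsol, hNR, hmin⟩ := hopt
  obtain ⟨-, hd, hc, hb⟩ :=
    ((isSolution_iff P F).1 hsol).resolve_left fun ⟨x, hx⟩ => hloop x hx
  set B := Metric.closedBall u r with hB
  set rest := F.filter fun e => ¬ ∀ x ∈ e, x ∈ B with hrest
  have hsplit : restrict F B + rest = F := by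
    rw [restrict, hrest]
    convert Multiset.filter_add_not (fun e => ∀ x ∈ e, x ∈ B) F
  have hwsplit : weight (restrict F B) + weight rest = weight F := by
    rw [← weight_add, hsplit]
  have hrestF : rest ⊆ F := Multiset.filter_subset _ _
  have hkeep : ∀ e ∈ F, ∀ x ∈ e, x ∉ B → e ∈ rest := fun e he x hx hxB =>
    Multiset.mem_filter.2 ⟨he, fun h => hxB (h x hx)⟩
  have hout : ∀ v ∈ vertexSet F, v ∉ B → v ∈ vertexSet rest :=
    fun v ⟨e, he, hve⟩ hvB => ⟨e, hkeep e he v hve hvB, hve⟩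
  have hBρ : B ⊆ Metric.closedBall u ρ := Metric.closedBall_subset_closedBall hrρ
  have hcrn : (0 : ℝ) ≤ 8 / 3 * s ^ j * Multiset.card (crossing F B (s ^ j / ε)) +
      14 * (s * R) * Q.card := by positivity
  by_cases hrest0 : rest = 0
  · -- `F` lies in the ball, so the local solution competes with `F` as it stands
    have h1 := hmin F' hF' hNR'
    have h2 := cost_le_of_vertexSet W (F := F) (F' := F') (F'' := F') (u := u) (ρ := ρ)
      fun v hv => by
        by_cases hvF : v ∈ vertexSet F
        · by_cases hvB : v ∈ B
          · exact Or.inr ⟨hBρ hvB, hv⟩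
          · obtain ⟨e, he, -⟩ := hout v hvF hvB
            simp [hrest0] at he
        · exact Or.inl hvF
    rw [hrest0, weight_zero] at hwsplit
    linarith
  -- points of `B` on leftover edges
  have hinner : ∀ x ∈ vertexSet rest, x ∈ B → ∃ b ∉ B, s(x, b) ∈ F := by
    rintro x ⟨e, he, hxe⟩ hxB
    obtain ⟨b, rfl⟩ := Sym2.mem_iff_exists.1 hxe
    rw [hrest, Multiset.mem_filter] at he
    refine ⟨b, fun hbB => he.2 fun y hy => ?_, he.1⟩
    rcases Sym2.mem_iff.1 hy with rfl | rfl <;> assumption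
  have : Fintype X := Fintype.ofFinite X
  choose q hqN hqJ using fun x => exists_climb hs hε hε1 hN x j
  let Y := (Finset.univ : Finset X).filter fun x => x ∈ vertexSet rest ∧ x ∈ B ∧ x ∉ N j
  have hY : ∀ x, x ∈ Y ↔ x ∈ vertexSet rest ∧ x ∈ B ∧ x ∉ N j := fun x => by simp [Y]
  -- such a point off the net lies on a short crossing edge
  have hYcard : Y.card ≤ Multiset.card (crossing F B (s ^ j / ε)) := by
    have hex : ∀ x, ∃ b, x ∈ Y → b ∉ B ∧ s(x, b) ∈ crossing F B (s ^ j / ε) := fun x => by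
      by_cases hx : x ∈ Y
      · obtain ⟨h1, h2, h3⟩ := (hY x).1 hx
        obtain ⟨b, hbB, hbF⟩ := hinner x h1 h2
        refine ⟨b, fun _ => ⟨hbB, mem_crossing.2 ⟨hbF, ?_, x, h2, b, hbB, rfl⟩⟩⟩
        rw [edgeLength_mk, lt_div_iff₀ hε, mul_comm]
        by_contra! hlong
        have hxb : 0 < ε * dist x b := hsj.trans_le hlong
        obtain ⟨l, hl1, hl2⟩ := exists_mem_Ico_zpow hxb (by linarith : 1 < s)
        have hjl : j ≤ l := by
          have := (zpow_lt_zpow_iff_right₀ (by linarith : 1 < s)).1 (hlong.trans_lt hl2)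
          omega
        exact h3 (hN.antitone hjl (hNR x b hbF l hl1 hl2).1)
      · exact ⟨x, fun h => absurd h hx⟩
    choose b hb using hex
    calc Y.card ≤ (crossing F B (s ^ j / ε)).toFinset.card := by
          refine Finset.card_le_card_of_injOn (fun x => s(x, b x))
            (fun x hx => by simpa using (hb x hx).2) fun x hx y hy hxy => ?_
          rcases Sym2.eq_iff.1 hxy with ⟨h, -⟩ | ⟨h, -⟩
          · exact h
          · exact absurd (h ▸ ((hY x).1 hx).2.1) (hb y hy).1
      _ ≤ _ := Multiset.toFinset_card_le _
  have hqQ : ∀ y ∈ Y, q y ∈ Q := fun y hy => (hQ _).2 ⟨hqN y, by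
    have h1 := Metric.mem_closedBall.1 ((hY y).1 hy).2.1
    have h2 := (hqJ y).dist_le
    rw [dist_comm] at h2
    rw [Metric.mem_closedBall]
    linarith [dist_triangle (q y) y u]⟩
  have hinnerQ : ∀ x ∈ B, x ∈ N j → x ∈ Q := fun x hx hxN => (hQ x).2 ⟨hxN,
    Metric.closedBall_subset_closedBall (by linarith) hx⟩
  have huQ : u ∈ Q := (hQ u).2 ⟨hu, Metric.mem_closedBall_self hR0.le⟩
  obtain ⟨D₁, h1N, h1d, h1w, h1V, h1Y, h1b⟩ := exists_connector rest Y q (4 / 3 * s ^ j)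
    (fun y _ h => ((hY _).1 h).2.2 (hqN y)) (fun y _ => hqJ y)
  obtain ⟨D₂, h2N, h2d, h2w, h2V, h2Y, h2b⟩ := exists_connector (s := s) (ε := ε) (N := N)
    (rest + D₁) (Q.erase u) (fun _ => u) (7 * (s * R)) (by simp) (fun y hy =>
      nrJoin_of_dist_le hs hε hε1 hN hR0 ((hQ y).1 (Finset.mem_of_mem_erase hy)).2)
  obtain ⟨A, hAN, hAd, hAb, hAw, hAV, hAF⟩ := exists_attached hs hε hε1 hN hF' hNR' u hρ
  set F'' := rest + D₁ + D₂ + A with hF''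
  have hs1 : rest ⊆ F'' := fun e he => by simp [hF'', he]
  have hs2 : D₁ ⊆ F'' := fun e he => by simp [hF'', he]
  have hs3 : D₂ ⊆ F'' := fun e he => by simp [hF'', he]
  have hs4 : A ⊆ F'' := fun e he => by simp [hF'', he]
  have hreachQ : ∀ p ∈ Q, (SimpleGraph.fromEdgeSet {e | e ∈ F''}).Reachable p u := by
    intro p hp
    by_cases hpu : p = u
    · subst hpu; rfl
    · exact reachable_mono hs3 (h2Y p (Finset.mem_erase.2 ⟨hpu, hp⟩))
  have hreach_rest : ∀ v ∈ vertexSet rest,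
      (SimpleGraph.fromEdgeSet {e | e ∈ F''}).Reachable v u := by
    intro v hv
    obtain ⟨e, he⟩ := Multiset.exists_mem_of_ne_zero hne
    rw [mem_restrict] at he
    induction e with | _ a b
    have hvF : v ∈ vertexSet F := by
      obtain ⟨e, he, hve⟩ := hv
      exact ⟨e, hrestF he, hve⟩
    obtain ⟨p⟩ := hc v hvF a ⟨s(a, b), he.1, by simp⟩
    obtain ⟨z, hzB, hz⟩ := exists_reachable_of_walk hkeep p (he.2 a (by simp))
    have hzV := mem_vertexSet_of_reachable hz hv
    refine (reachable_mono hs1 hz).trans ?_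
    by_cases hzN : z ∈ N j
    · exact hreachQ z (hinnerQ z hzB hzN)
    · have hzY : z ∈ Y := (hY z).2 ⟨hzV, hzB, hzN⟩
      exact (reachable_mono hs2 (h1Y z hzY)).trans (hreachQ _ (hqQ z hzY))
  have hreach : ∀ v ∈ vertexSet F'',
      (SimpleGraph.fromEdgeSet {e | e ∈ F''}).Reachable v u := by
    intro v hv
    rw [hF'', vertexSet_add, vertexSet_add, vertexSet_add] at hv
    rcases hv with ((hv | hv) | hv) | hv
    · exact hreach_rest v hv
    · obtain ⟨y, hy, hvy⟩ := h1V v hv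
      exact (reachable_mono hs2 hvy).trans (hreachQ _ (hqQ y hy))
    · obtain ⟨y, hy, hvy⟩ := h2V v hv
      exact reachable_mono hs3 hvy
    · exact reachable_mono hs4 (hAV v hv)
  have hsol'' : IsSolution P F'' := by
    refine (isSolution_iff P F'').2 (Or.inr ⟨?_, ?_, ?_, ?_⟩)
    · intro h
      obtain ⟨e, he⟩ := Multiset.exists_mem_of_ne_zero hrest0
      have := hs1 he
      simp [h] at this
    · intro e he
      simp only [hF'', Multiset.mem_add] at he
      rcases he with ((he | he) | he) | he
      exacts [hd e (hrestF he), h1d e he, h2d e he, hAd e he]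
    · exact fun x hx y hy => (hreach x hx).trans (hreach y hy).symm
    · intro htsp
      -- all parity has been moved to `u`, where the handshake lemma makes it vanish
      have hsupp : ∀ v, v ≠ u → boundary (rest + D₁ + D₂) v = 0 := by
        intro v hvu
        by_contra hv
        obtain ⟨hvQ, h⟩ := h2b v hv
        have hv1 := h.resolve_right (by simpa using fun _ _ _ => hvu)
        refine hvQ (Finset.mem_erase.2 ⟨hvu, ?_⟩)
        obtain ⟨hvY, h⟩ := h1b v hv1
        rcases h with h | ⟨y, hy, rfl⟩
        · have hV : v ∈ vertexSet rest := by
            obtain ⟨w, hw⟩ := exists_mem_of_boundary_ne_zero h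
            exact ⟨_, hw, by simp⟩
          have hvB : v ∈ B := by
            have h2 : boundary (restrict F B) v ≠ 0 := by
              intro h0
              have := congrFun (hb htsp) v
              rw [← hsplit, boundary_add, Pi.add_apply, h0, zero_add] at this
              exact h this
            obtain ⟨w, hw⟩ := exists_mem_of_boundary_ne_zero h2
            rw [mem_restrict] at hw
            exact hw.2 v (by simp)
          refine hinnerQ v hvB ?_
          by_contra hvN
          exact hvY ((hY v).2 ⟨hV, hvB, hvN⟩)
        · exact hqQ y hy
      rw [hF'', boundary_add, hAb htsp, add_zero]
      funext v
      by_cases hvu : v = u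
      · subst hvu
        rw [← Fintype.sum_eq_single v hsupp]
        exact sum_boundary _
      · exact hsupp v hvu
  have hNR'' : NetRespecting s ε N F'' := (((hNR.mono hrestF).add h1N).add h2N).add hAN
  have huV : u ∈ vertexSet F'' := by
    obtain ⟨e, he⟩ := Multiset.exists_mem_of_ne_zero hrest0
    induction e with | _ a b
    exact mem_vertexSet_of_reachable (hreach_rest a ⟨_, he, by simp⟩) ⟨_, hs1 he, by simp⟩
  have hcost := cost_le_of_vertexSet W (F := F) (F' := F') (F'' := F'') (u := u) (ρ := ρ)
    fun v hv => by
      by_contra! hcon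
      obtain ⟨hvF, hvF'⟩ := hcon
      by_cases hvρ : v ∈ Metric.closedBall u ρ
      · exact hv (mem_vertexSet_of_reachable
          (reachable_mono hs4 (hAF v (hvF' hvρ) hvρ)).symm huV)
      · obtain ⟨e, he, hve⟩ := hout v hvF fun h => hvρ (hBρ h)
        exact hv ⟨e, hs1 he, hve⟩
  have hw : weight F'' = weight rest + weight D₁ + weight D₂ + weight A := by
    rw [hF'', weight_add, weight_add, weight_add]
  have hQ1 : ((Q.erase u).card : ℝ) + 1 = Q.card := by
    exact_mod_cast Finset.card_erase_add_one huQ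
  have hY' : (Y.card : ℝ) ≤ Multiset.card (crossing F B (s ^ j / ε)) := by exact_mod_cast hYcard
  have hsρ : s * ρ ≤ s * R := by gcongr; linarith
  have h3 := hmin F'' hsol'' hNR''
  have h4 : s ^ j * Y.card ≤ s ^ j * Multiset.card (crossing F B (s ^ j / ε)) := by gcongr
  rw [← hQ1]
  linarith

end

/-! ### Growth of the weight inside balls of increasing radius -/

section
variable {X : Type*} [MetricSpace X] {s ε k : ℝ} {N : ℤ → Set X}

open Classical in
lemma weight_restrict_cons (e : Sym2 X) (F : Multiset (Sym2 X)) (S : Set X) :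
    weight (restrict (e ::ₘ F) S) =
      (if ∀ x ∈ e, x ∈ S then edgeLength e else 0) + weight (restrict F S) := by
  by_cases h : ∀ x ∈ e, x ∈ S
  · rw [restrict, Multiset.filter_cons_of_pos _ h, weight_cons, if_pos h]; rfl
  · rw [restrict, Multiset.filter_cons_of_neg _ h, if_neg h, zero_add]; rfl

open Classical in
lemma card_crossing_cons (e : Sym2 X) (F : Multiset (Sym2 X)) (S : Set X) (ℓ : ℝ) :
    (Multiset.card (crossing (e ::ₘ F) S ℓ) : ℝ) =
      (if edgeLength e < ℓ ∧ ∃ a ∈ S, ∃ b ∉ S, e = s(a, b) then 1 else 0) +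
        Multiset.card (crossing F S ℓ) := by
  have := congrArg Multiset.card (Multiset.filter_cons (a := e) F
    (p := fun e => edgeLength e < ℓ ∧ ∃ a ∈ S, ∃ b ∉ S, e = s(a, b)))
  rw [crossing, this, Multiset.card_add, Nat.cast_add]
  congr 1
  split_ifs <;> simp

lemma weight_restrict_mono (F : Multiset (Sym2 X)) {S T : Set X} (h : S ⊆ T) :
    weight (restrict F S) ≤ weight (restrict F T) := by
  classical
  induction F using Multiset.induction with
  | empty => simp [restrict]
  | cons e F ih =>
    rw [weight_restrict_cons, weight_restrict_cons]
    refine add_le_add ?_ ih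
    by_cases hS : ∀ x ∈ e, x ∈ S
    · rw [if_pos hS, if_pos fun x hx => h (hS x hx)]
    · rw [if_neg hS]
      split_ifs
      exacts [edgeLength_nonneg e, le_rfl]

lemma weight_restrict_le_weight (F : Multiset (Sym2 X)) (S : Set X) :
    weight (restrict F S) ≤ weight F := by
  have h := weight_restrict_mono F (Set.subset_univ S)
  have : restrict F Set.univ = F := by simp [restrict]
  rwa [this] at h

open Classical in
/-- A single edge is counted as a short crossing edge for a set of radii of measure at most its
length. -/
lemma integral_crossing_edge (e : Sym2 X) (u : X) {r D ℓ : ℝ} (hD : 0 ≤ D) (hℓ : 0 ≤ ℓ) :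
    IntervalIntegrable (fun r' => if edgeLength e < ℓ ∧ ∃ a ∈ Metric.closedBall u r',
        ∃ b ∉ Metric.closedBall u r', e = s(a, b) then (1 : ℝ) else 0)
      MeasureTheory.volume r (r + D) ∧
    (∫ r' in r..(r + D), if edgeLength e < ℓ ∧ ∃ a ∈ Metric.closedBall u r',
        ∃ b ∉ Metric.closedBall u r', e = s(a, b) then (1 : ℝ) else 0) +
      (if ∀ x ∈ e, x ∈ Metric.closedBall u r then edgeLength e else 0) ≤
      if ∀ x ∈ e, x ∈ Metric.closedBall u (r + D + ℓ) then edgeLength e else 0 := by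
  induction e with | _ a b
  wlog hab : dist a u ≤ dist b u generalizing a b
  · have := this b a (le_of_not_ge hab)
    rwa [Sym2.eq_swap]
  have htri : dist b u - dist a u ≤ edgeLength s(a, b) := by
    rw [edgeLength_mk]
    linarith [dist_triangle b a u, dist_comm a b]
  have hd0 := edgeLength_nonneg s(a, b)
  have hall : ∀ ρ, (∀ x ∈ s(a, b), x ∈ Metric.closedBall u ρ) ↔ dist b u ≤ ρ := fun ρ => by
    simp only [Sym2.mem_iff, forall_eq_or_imp, forall_eq, Metric.mem_closedBall]
    exact ⟨fun h => h.2, fun h => ⟨hab.trans h, h⟩⟩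
  have hmono : (if dist b u ≤ r then edgeLength s(a, b) else 0) ≤
      if dist b u ≤ r + D + ℓ then edgeLength s(a, b) else 0 := by
    split_ifs <;> linarith
  simp only [hall]
  by_cases hlt : edgeLength s(a, b) < ℓ
  swap
  · simp only [hlt, false_and, if_false, intervalIntegral.integral_zero, zero_add]
    exact ⟨by simp, hmono⟩
  have hfun : (fun r' => if edgeLength s(a, b) < ℓ ∧ ∃ a' ∈ Metric.closedBall u r',
      ∃ b' ∉ Metric.closedBall u r', s(a, b) = s(a', b') then (1 : ℝ) else 0) =
      (Set.Ico (dist a u) (dist b u)).indicator 1 := by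
    funext r'
    rw [Set.indicator_apply]
    refine if_congr ⟨?_, fun h => ⟨hlt, a, h.1, b, not_le.2 h.2, rfl⟩⟩ rfl rfl
    rintro ⟨-, a', ha', b', hb', he⟩
    rcases Sym2.eq_iff.1 he with ⟨rfl, rfl⟩ | ⟨rfl, rfl⟩
    · exact ⟨ha', not_le.1 hb'⟩
    · exact absurd (hab.trans ha') hb'
  rw [hfun]
  have hint : MeasureTheory.Integrable
      ((Set.Ico (dist a u) (dist b u)).indicator (1 : ℝ → ℝ)) := by
    rw [MeasureTheory.integrable_indicator_iff measurableSet_Ico]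
    exact MeasureTheory.integrableOn_const (by simp)
  refine ⟨hint.intervalIntegrable, ?_⟩
  have hle : ∀ S : Set ℝ, ∫ r' in S, (Set.Ico (dist a u) (dist b u)).indicator (1 : ℝ → ℝ) r' ≤
      dist b u - dist a u := fun S => by
    calc _ ≤ ∫ r', (Set.Ico (dist a u) (dist b u)).indicator (1 : ℝ → ℝ) r' :=
          MeasureTheory.setIntegral_le_integral hint
            (Filter.Eventually.of_forall fun x => Set.indicator_nonneg (by simp) x)
      _ = dist b u - dist a u := by
          rw [MeasureTheory.integral_indicator_one measurableSet_Ico,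
            Real.volume_real_Ico_of_le hab]
  rw [intervalIntegral.integral_of_le (by linarith)]
  by_cases hbr : dist b u ≤ r
  · rw [MeasureTheory.setIntegral_eq_zero_of_forall_eq_zero fun x hx => ?_, zero_add]
    · exact hmono
    · exact Set.indicator_of_notMem (fun h => by have := h.2; have := hx.1; linarith) _
  rw [if_neg hbr, add_zero]
  by_cases har : dist a u ≤ r + D
  · rw [if_pos (by linarith)]
    exact (hle _).trans htri
  · rw [MeasureTheory.setIntegral_eq_zero_of_forall_eq_zero fun x hx => ?_]
    · split_ifs <;> linarith
    · exact Set.indicator_of_notMem (fun h => by have := h.1; have := hx.2; linarith) _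

/-- If at least `n` edges shorter than `ℓ` cross each sphere of radius in `[r, r + D]`, then the
weight inside the ball grows by at least `D * n` between the radii `r` and `r + D + ℓ`. -/
lemma weight_restrict_add_le (F : Multiset (Sym2 X)) (u : X) {r D ℓ n : ℝ} (hD : 0 ≤ D)
    (hℓ : 0 ≤ ℓ) (hn : ∀ r' ∈ Set.Icc r (r + D),
      n ≤ Multiset.card (crossing F (Metric.closedBall u r') ℓ)) :
    weight (restrict F (Metric.closedBall u r)) + D * n ≤
      weight (restrict F (Metric.closedBall u (r + D + ℓ))) := by
  classical
  have key : IntervalIntegrable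
        (fun r' => (Multiset.card (crossing F (Metric.closedBall u r') ℓ) : ℝ))
        MeasureTheory.volume r (r + D) ∧
      (∫ r' in r..(r + D), (Multiset.card (crossing F (Metric.closedBall u r') ℓ) : ℝ)) +
        weight (restrict F (Metric.closedBall u r)) ≤
      weight (restrict F (Metric.closedBall u (r + D + ℓ))) := by
    clear hn
    induction F using Multiset.induction with
    | empty => simp [crossing, restrict]
    | cons e F ih =>
      obtain ⟨h1, h2⟩ := integral_crossing_edge e u (r := r) hD hℓ
      simp only [card_crossing_cons, weight_restrict_cons]
      refine ⟨h1.add ih.1, ?_⟩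
      rw [intervalIntegral.integral_add h1 ih.1]
      linarith [ih.2]
  have h := intervalIntegral.integral_mono_on (by linarith : r ≤ r + D)
    (intervalIntegrable_const (c := n)) key.1 hn
  rw [intervalIntegral.integral_const, smul_eq_mul] at h
  linarith [key.2]

lemma cost_nonneg (W : Instance X) (F : Multiset (Sym2 X)) : 0 ≤ cost W F :=
  add_nonneg (weight_nonneg F) (Finset.sum_nonneg fun _ _ => NNReal.coe_nonneg _)

end

lemma sum_zpow_sub_le {s : ℝ} (hs : 4 ≤ s) (j : ℤ) (q : ℕ) :
    ∑ p ∈ Finset.range q, s ^ (j - p) ≤ 4 / 3 * (s ^ j - s ^ (j - q)) := by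
  have hs0 : 0 < s := by linarith
  induction q with
  | zero => simp
  | succ q ih =>
    rw [Finset.sum_range_succ]
    have h1 : s ^ (j - q) = s ^ (j - (q + 1 : ℕ)) * s := by
      rw [← zpow_add_one₀ hs0.ne']; congr 1; push_cast; ring
    have h2 : 0 < s ^ (j - (q + 1 : ℕ)) := by positivity
    nlinarith

/-- The threshold on the excess weight above which a phase of the growth argument at height `j`
can be carried out. -/
noncomputable def threshold (s k R : ℝ) (j : ℤ) : ℝ := 28 * (s * R) * (8 * R / s ^ j) ^ k

lemma threshold_sub_one {s k R : ℝ} (hs : 4 ≤ s) (hR : 0 < R) (j : ℤ) :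
    threshold s k R (j - 1) = s ^ k * threshold s k R j := by
  have hs0 : 0 < s := by linarith
  have hp : 0 < s ^ j := by positivity
  have : 8 * R / s ^ (j - 1) = s * (8 * R / s ^ j) := by
    rw [zpow_sub_one₀ hs0.ne']; field_simp
  rw [threshold, this, Real.mul_rpow hs0.le (by positivity), threshold]; ring

lemma threshold_pos {s k R : ℝ} (hs : 4 ≤ s) (hR : 0 < R) (j : ℤ) : 0 < threshold s k R j := by
  have hs0 : 0 < s := by linarith
  rw [threshold]; positivity

lemma exists_rpow_le_two_pow {s k : ℝ} (hs : 4 ≤ s) (hk : 1 ≤ k) :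
    ∃ M : ℕ, s ^ k ≤ 2 ^ M ∧ (M : ℝ) ≤ 2 * (k * s) := by
  refine ⟨⌈k * s⌉₊, ?_, ?_⟩
  · have h1 : s ≤ (2 : ℝ) ^ s := by
      have := one_add_mul_self_le_rpow_one_add (by norm_num : (-1 : ℝ) ≤ 1) (by linarith : 1 ≤ s)
      norm_num at this
      linarith
    calc s ^ k ≤ ((2 : ℝ) ^ s) ^ k := Real.rpow_le_rpow (by linarith) h1 (by linarith)
      _ = (2 : ℝ) ^ (k * s) := by rw [← Real.rpow_mul (by norm_num), mul_comm]
      _ ≤ (2 : ℝ) ^ ((⌈k * s⌉₊ : ℕ) : ℝ) :=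
        Real.rpow_le_rpow_of_exponent_le (by norm_num) (Nat.le_ceil _)
      _ = 2 ^ ⌈k * s⌉₊ := Real.rpow_natCast _ _
  · have h0 : 1 ≤ k * s := by nlinarith
    have := (Nat.ceil_lt_add_one (by linarith : 0 ≤ k * s)).le
    linarith

/-- Suppose that `h`, once it is above the threshold of height `j`, doubles whenever the radius grows
by `7 s ^ j / ε`. Being bounded, `h` cannot start above the threshold of a height `j₀` for which
`s ^ j₀` is small compared with the available range of radii: the thresholds of the heights
`j₀, j₀ - 1, …` would all be passed before the end of the range, as the phases have geometrically
decreasing lengths. -/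
lemma le_threshold_of_doubling {s ε k R : ℝ} (hs : 4 ≤ s) (hε : 0 < ε) (hk : 1 ≤ k) (hR : 0 < R)
    {h : ℝ → ℝ} {b : ℝ} (hb : ∀ r, h r ≤ b) {r₀ ρ : ℝ} {j₀ : ℤ}
    (hj₀ : 19 * (k * s) * s ^ j₀ / ε ≤ ρ - r₀)
    (hstep : ∀ j ≤ j₀, ∀ r H, r₀ ≤ r → threshold s k R j ≤ H → H ≤ h r →
      r + 7 * s ^ j / ε ≤ ρ → 2 * H ≤ h (r + 7 * s ^ j / ε)) :
    h r₀ ≤ threshold s k R j₀ := by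
  have hs0 : 0 < s := by linarith
  by_contra! hgt
  obtain ⟨M, hM, hMle⟩ := exists_rpow_le_two_pow hs hk
  have hphase : ∀ j ≤ j₀, ∀ r, r₀ ≤ r → threshold s k R j ≤ h r →
      ∀ a : ℕ, r + a * (7 * s ^ j / ε) ≤ ρ →
        2 ^ a * threshold s k R j ≤ h (r + a * (7 * s ^ j / ε)) := by
    intro j hj r hr hth a
    have hΔ : 0 < 7 * s ^ j / ε := by positivity
    have hpos := threshold_pos (k := k) hs hR j
    induction a with
    | zero => intro _; simpa using hth
    | succ a ih =>
      intro hle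
      have he : r + ((a + 1 : ℕ) : ℝ) * (7 * s ^ j / ε) =
          r + a * (7 * s ^ j / ε) + 7 * s ^ j / ε := by push_cast; ring
      rw [he] at hle ⊢
      have hH : threshold s k R j ≤ 2 ^ a * threshold s k R j :=
        le_mul_of_one_le_left hpos.le (one_le_pow₀ (by norm_num))
      have := hstep j hj (r + a * (7 * s ^ j / ε)) (2 ^ a * threshold s k R j)
        (by have : 0 ≤ a * (7 * s ^ j / ε) := by positivity
            linarith) hH (ih (by linarith)) hle
      rw [pow_succ]; linarith
  set τ : ℕ → ℝ := fun q => ∑ p ∈ Finset.range q, M * (7 * s ^ (j₀ - p) / ε) with hτ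
  have hτle : ∀ q, r₀ + τ q ≤ ρ := by
    intro q
    have h1 : τ q = M * 7 / ε * ∑ p ∈ Finset.range q, s ^ (j₀ - p) := by
      rw [hτ, Finset.mul_sum]
      exact Finset.sum_congr rfl fun p _ => by ring
    have h2 := sum_zpow_sub_le hs j₀ q
    have h3 : 0 < s ^ (j₀ - q) := by positivity
    have hp : 0 < s ^ j₀ := by positivity
    have h4 : τ q ≤ 2 * (k * s) * 7 / ε * (4 / 3 * s ^ j₀) := by
      rw [h1]
      gcongr
      linarith
    have h5 : 2 * (k * s) * 7 / ε * (4 / 3 * s ^ j₀) ≤ 19 * (k * s) * s ^ j₀ / ε := by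
      have : 0 ≤ k * s * s ^ j₀ / ε := by positivity
      have e1 : 2 * (k * s) * 7 / ε * (4 / 3 * s ^ j₀) = 56 / 3 * (k * s * s ^ j₀ / ε) := by ring
      have e2 : 19 * (k * s) * s ^ j₀ / ε = 19 * (k * s * s ^ j₀ / ε) := by ring
      rw [e1, e2]; linarith
    linarith
  have hτ0 : ∀ q, 0 ≤ τ q := fun q => Finset.sum_nonneg fun p _ => by positivity
  have hmain : ∀ q : ℕ, threshold s k R (j₀ - q) ≤ h (r₀ + τ q) := by
    intro q
    induction q with
    | zero => simpa [hτ] using hgt.le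
    | succ q ih =>
      have hsucc : r₀ + τ (q + 1) = r₀ + τ q + M * (7 * s ^ (j₀ - q) / ε) := by
        simp only [hτ, Finset.sum_range_succ]; ring
      have := hphase (j₀ - q) (by omega) (r₀ + τ q) (by linarith [hτ0 q]) ih M
        (hsucc ▸ hτle (q + 1))
      rw [← hsucc] at this
      have he : j₀ - ((q + 1 : ℕ) : ℤ) = j₀ - q - 1 := by push_cast; ring
      rw [he, threshold_sub_one hs hR]
      exact (mul_le_mul_of_nonneg_right hM (threshold_pos hs hR _).le).trans this
  have hgeom : ∀ q : ℕ, threshold s k R (j₀ - q) = (s ^ k) ^ q * threshold s k R j₀ := by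
    intro q
    induction q with
    | zero => simp
    | succ q ih =>
      have he : j₀ - ((q + 1 : ℕ) : ℤ) = j₀ - q - 1 := by push_cast; ring
      rw [he, threshold_sub_one hs hR, ih, pow_succ]; ring
  have hsk : 1 < s ^ k := Real.one_lt_rpow (by linarith) (by linarith)
  have hT := threshold_pos (k := k) hs hR j₀
  obtain ⟨q, hq⟩ := pow_unbounded_of_one_lt (b / threshold s k R j₀) hsk
  rw [div_lt_iff₀ hT, ← hgeom q] at hq
  linarith [hmain q, hb (r₀ + τ q)]

/-- The threshold at the height where `s ^ j` is just below `ε s ^ i / (19 k s)`. -/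
lemma threshold_le {s ε k t : ℝ} (hs : 4 ≤ s) (hε : 0 < ε) (hε1 : ε < 1) (hk : 1 ≤ k) (ht : 1 ≤ t)
    {i j : ℤ} (hj : ε * s ^ i / (19 * (k * s)) < s ^ (j + 1)) :
    threshold s k (3 * (t * s ^ i)) j ≤ (40 * (s * k * t / ε)) ^ (3 * k) * s ^ i := by
  have hs0 : 0 < s := by linarith
  have hi : 0 < s ^ i := by positivity
  have hjp : 0 < s ^ j := by positivity
  set y := s * k * t / ε with hy
  have hyst : s * t ≤ y := by
    rw [hy, le_div_iff₀ hε]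
    have : 0 < s * t := by positivity
    nlinarith
  have hys : s ≤ y := by nlinarith
  have hy1 : 1 ≤ y := by linarith
  have h1 : 8 * (3 * (t * s ^ i)) / s ^ j ≤ 456 * y ^ 2 := by
    rw [div_lt_iff₀ (by positivity), zpow_add_one₀ hs0.ne'] at hj
    rw [div_le_iff₀ hjp]
    have h2 : s ^ i ≤ s ^ j * s * (19 * (k * s)) / ε := by
      rw [le_div_iff₀ hε]; linarith
    calc 8 * (3 * (t * s ^ i)) ≤ 8 * (3 * (t * (s ^ j * s * (19 * (k * s)) / ε))) := by gcongr
      _ = 456 * (s * y) * s ^ j := by rw [hy]; ring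
      _ ≤ 456 * y ^ 2 * s ^ j := by rw [sq]; gcongr
  calc threshold s k (3 * (t * s ^ i)) j
      = 84 * (s * t) * (8 * (3 * (t * s ^ i)) / s ^ j) ^ k * s ^ i := by rw [threshold]; ring
    _ ≤ 84 * y * (456 * y ^ 2) ^ k * s ^ i := by gcongr
    _ ≤ (84 * y) ^ k * (456 * y ^ 2) ^ k * s ^ i := by
        gcongr
        exact Real.self_le_rpow_of_one_le (by linarith) hk
    _ = (84 * y * (456 * y ^ 2)) ^ k * s ^ i := by
        rw [Real.mul_rpow (x := 84 * y) (y := 456 * y ^ 2) (by positivity) (by positivity)]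
    _ ≤ ((40 * y) ^ (3 : ℝ)) ^ k * s ^ i := by
        have : 84 * y * (456 * y ^ 2) ≤ (40 * y) ^ (3 : ℝ) := by
          have e : (40 * y) ^ (3 : ℝ) = (40 * y) ^ 3 := by exact_mod_cast Real.rpow_natCast _ 3
          rw [e]
          have : 0 ≤ y ^ 3 := by positivity
          nlinarith
        gcongr
    _ = (40 * y) ^ (3 * k) * s ^ i := by rw [← Real.rpow_mul (by positivity)]

section
variable {X : Type*} [MetricSpace X] {s ε k : ℝ} {N : ℤ → Set X}

/-- One doubling: while the excess over the cost of the local solution is at least `H`, many short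
edges cross every sphere, by the exchange inequality. -/
lemma two_mul_le_excess [Finite X] {P : Problem} (hX : DoublingDimLE X k) (hk : 0 ≤ k)
    (hX1 : ∀ x y : X, x ≠ y → 1 ≤ dist x y) (hs : 4 ≤ s) (hε : 0 < ε) (hε1 : ε < 1)
    (hN : IsHierarchicalNet s N) {W : Instance X} {F F' : Multiset (Sym2 X)}
    (hopt : IsOptimalNR P s ε N W F) (hloop : ∀ x : X, F ≠ {s(x, x)})
    (hF' : IsSolution P F') (hNR' : NetRespecting s ε N F')
    {u : X} {r ρ R H : ℝ} {j : ℤ} (hu : u ∈ N j) (hρ : 0 < ρ)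
    (hρR : ρ + 4 / 3 * s ^ j ≤ R) (hH : threshold s k R j ≤ H)
    (hHr : H ≤ weight (restrict F (Metric.closedBall u r)) - cost (W.subBall u ρ) F')
    (hr : r + 7 * s ^ j / ε ≤ ρ) :
    2 * H ≤ weight (restrict F (Metric.closedBall u (r + 7 * s ^ j / ε))) -
      cost (W.subBall u ρ) F' := by
  classical
  have hs0 : 0 < s := by linarith
  have hsj : 0 < s ^ j := by positivity
  have hR : 0 < R := by linarith
  have hH0 : 0 < H := (threshold_pos hs hR j).trans_le hH
  have hc := cost_nonneg (W.subBall u ρ) F'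
  have : Fintype X := Fintype.ofFinite X
  have hjε : s ^ j ≤ s ^ j / ε := by rw [le_div_iff₀ hε]; nlinarith
  have h7 : r + 6 * s ^ j + s ^ j / ε ≤ r + 7 * s ^ j / ε := by
    rw [mul_div_assoc]; linarith
  have hcross : ∀ r' ∈ Set.Icc r (r + 6 * s ^ j), 3 * H / (16 * s ^ j) ≤
      Multiset.card (crossing F (Metric.closedBall u r') (s ^ j / ε)) := by
    intro r' hr'
    have hmono := weight_restrict_mono F
      (Metric.closedBall_subset_closedBall (x := u) hr'.1)
    have hne : restrict F (Metric.closedBall u r') ≠ 0 := by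
      intro h0
      rw [h0, weight_zero] at hmono
      linarith
    let Q := (Finset.univ : Finset X).filter fun p => p ∈ N j ∧ p ∈ Metric.closedBall u R
    have hQ : ∀ p, p ∈ Q ↔ p ∈ N j ∧ p ∈ Metric.closedBall u R := fun p => by simp [Q]
    have hex := weight_restrict_le hs hε hε1 hN hopt hloop hF' hNR' hu
      (by linarith [hr'.2] : r' ≤ ρ) hρ hρR hne hQ
    have hcard := card_net_le hX hk hs hN hX1 (by linarith : s ^ j ≤ R) fun p hp => (hQ p).1 hp
    have hhalf : 14 * (s * R) * Q.card ≤ H / 2 := by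
      have : 14 * (s * R) * Q.card ≤ 14 * (s * R) * (8 * R / s ^ j) ^ k := by gcongr
      rw [threshold] at hH
      linarith
    rw [div_le_iff₀ (by positivity)]
    linarith
  have h1 := weight_restrict_add_le F u (by positivity : 0 ≤ 6 * s ^ j)
    (by positivity : 0 ≤ s ^ j / ε) hcross
  have h2 := weight_restrict_mono F (Metric.closedBall_subset_closedBall (x := u) h7)
  have h3 : 6 * s ^ j * (3 * H / (16 * s ^ j)) = 9 / 8 * H := by field_simp; norm_num
  linarith

lemma DoublingDimLE.nonneg (hX : DoublingDimLE X k) (u : X) : 0 ≤ k := by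
  obtain ⟨Z, hZ, hcov⟩ := hX u 1 one_pos
  obtain ⟨z, hz, -⟩ := Set.mem_iUnion₂.1 (hcov (Metric.mem_closedBall_self (by norm_num)))
  have h1 : (1 : ℝ) ≤ Z.card := by exact_mod_cast Finset.card_pos.2 ⟨z, hz⟩
  have : (2 : ℝ) ^ (0 : ℝ) ≤ (2 : ℝ) ^ k := by rw [Real.rpow_zero]; linarith
  exact (Real.rpow_le_rpow_left_iff (by norm_num)).1 this

end

end PrizeCollecting

/-! ### The local sparsity estimate -/

theorem mainTheorem3 :
    ∃ C₁ C₂ : ℝ, 0 < C₁ ∧ 0 < C₂ ∧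
      ∀ (P : PrizeCollecting.Problem) (X : Type*) [MetricSpace X] [Finite X]
        (k s ε : ℝ) (N : ℤ → Set X) (W : PrizeCollecting.Instance X) (F : Multiset (Sym2 X)),
        PrizeCollecting.DoublingDimLE X k →
        (∀ x y : X, x ≠ y → 1 ≤ dist x y) →
        4 ≤ s → 0 < ε → ε < 1 →
        PrizeCollecting.IsHierarchicalNet s N →
        PrizeCollecting.IsOptimalNR P s ε N W F →
        ∀ (i : ℤ) (u : X) (t : ℝ), 1 ≤ i → u ∈ N i → 1 ≤ t →
          ∀ F' : Multiset (Sym2 X),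
            PrizeCollecting.IsSolution P F' → PrizeCollecting.NetRespecting s ε N F' →
            PrizeCollecting.weight
                (PrizeCollecting.restrict F (Metric.closedBall u (t * s ^ i))) ≤
              PrizeCollecting.cost (W.subBall u ((t + 1) * s ^ i)) F' +
                (C₁ * (s * k * t / ε)) ^ (C₂ * k) * s ^ i := by
  refine ⟨40, 3, by norm_num, by norm_num, ?_⟩
  intro P X _ _ k s ε N W F hX hX1 hs hε hε1 hN hopt i u t hi hu ht F' hF' hNR'
  have hs0 : 0 < s := by linarith
  have hsi : 0 < s ^ i := by positivity
  have hk0 := hX.nonneg u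
  have hc := PrizeCollecting.cost_nonneg (W.subBall u ((t + 1) * s ^ i)) F'
  have herr : 0 ≤ (40 * (s * k * t / ε)) ^ (3 * k) * s ^ i := by positivity
  -- no edges of positive length: a self-loop, or a space with a single point
  by_cases hw : PrizeCollecting.weight F = 0
  · have := PrizeCollecting.weight_restrict_le_weight F (Metric.closedBall u (t * s ^ i))
    linarith
  have hloop : ∀ x : X, F ≠ {s(x, x)} := by
    rintro x rfl
    simp [PrizeCollecting.weight] at hw
  have hnt : Nontrivial X := by
    by_contra hsub
    rw [not_nontrivial_iff_subsingleton] at hsub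
    refine hw (Multiset.sum_eq_zero fun a ha => ?_)
    obtain ⟨e, -, rfl⟩ := Multiset.mem_map.1 ha
    induction e with | _ a b
    simp [Subsingleton.elim a b]
  have hk := hX.one_le
  -- the net of height `j` is the one used for patching in the first phase
  obtain ⟨j, hj1, hj2⟩ := exists_mem_Ico_zpow
    (by positivity : 0 < ε * s ^ i / (19 * (k * s))) (by linarith : 1 < s)
  have hjb : 19 * (k * s) * s ^ j ≤ ε * s ^ i := by
    rw [le_div_iff₀ (by positivity)] at hj1; linarith
  have hji : 76 * s ^ j ≤ s ^ i := by
    have h1 : 0 < s ^ j := by positivity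
    have h2 : 4 ≤ k * s := by nlinarith
    nlinarith
  have hjlt : j < i := by
    refine (zpow_lt_zpow_iff_right₀ (by linarith : 1 < s)).1 ?_
    have : 0 < s ^ j := by positivity
    linarith
  have hR : 0 < 3 * (t * s ^ i) := by positivity
  have hmain := PrizeCollecting.le_threshold_of_doubling hs hε hk hR
    (h := fun r => PrizeCollecting.weight (PrizeCollecting.restrict F (Metric.closedBall u r)) -
      PrizeCollecting.cost (W.subBall u ((t + 1) * s ^ i)) F')
    (b := PrizeCollecting.weight F) (r₀ := t * s ^ i) (ρ := (t + 1) * s ^ i) (j₀ := j)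
    (fun r => by
      have := PrizeCollecting.weight_restrict_le_weight F (Metric.closedBall u r)
      linarith)
    (by rw [div_le_iff₀ hε]; linarith)
    (fun l hl r H _ hH hHr hr => by
      refine PrizeCollecting.two_mul_le_excess hX hk0 hX1 hs hε hε1 hN hopt hloop hF' hNR'
        (hN.antitone (hl.trans hjlt.le) hu) (by positivity) ?_ hH hHr hr
      have : s ^ l ≤ s ^ j := zpow_le_zpow_right₀ (by linarith) hl
      nlinarith)
  have hfin := PrizeCollecting.threshold_le hs hε hε1 hk ht hj2
  linarith
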